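/- Consider a random access machine with finitely many program-named registers and an unbounded memory whose cells are addressed by the contents of registers; every cell holds a natural number. Its programs are built from the empty program, loading of constants, addition, truncated subtraction, indirect load and indirect store by sequencing, branching on whether a register is zero, and while-loops that run as long as a register is nonzero. Time is measured with logarithmic cost: every executed operation and every evaluated test is charged the total binary length of the constant, operands and memory addresses that it uses (the binary length of $x$ is $\lfloor\log_2 x\rfloor+1$ for $x\ge 1$, and is $1$ for $x=0$), and each empty program is charged $1$. The multiplication table of a group of order $n$, with its elements numbered $0,\dots,n-1$ in any order, is the $n\times n$ array whose entry $(i,j)$ is the number of the product of the elements numbered $i$ and $j$. **Theorem.** There are a single deterministic program of this kind and an absolute constant $C$ with the following property. Let $G$ and $H$ be groups of the same finite order $n\ge 1$, given to the program by $n$ and their multiplication tables with respect to arbitrary numberings of their elements. Then the program halts, and it accepts if and only if $G\cong H$. Moreover, if $n\ge 2$ and $p$ is the smallest prime dividing $n$, its running time on this input is at most $$ n^{\frac12\log_p n + C}. $$ -/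

import Mathlib

/-!
# A random access machine with logarithmic cost, and group tables as its input
-/

namespace RAM

/-- A configuration of the machine: registers, named by the program, and a memory, reached only
through addresses held in registers. Every cell holds a natural number. -/
@[ext]
structure State where
  reg : ℕ → ℕ
  mem : ℕ → ℕ

/-- Store `v` in register `i`. -/
def State.setReg (s : State) (i v : ℕ) : State :=
  { s with reg := Function.update s.reg i v }

/-- Store `v` in the memory cell with address `a`. -/
def State.setMem (s : State) (a v : ℕ) : State :=
  { s with mem := Function.update s.mem a v }

/-- Programs. A program is a finite object, so it mentions finitely many registers and constants. -/
inductive Prog where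
  /-- do nothing -/
  | skip : Prog
  /-- `r_i := k` for a constant `k` -/
  | const (i k : ℕ) : Prog
  /-- `r_i := r_j + r_k` -/
  | add (i j k : ℕ) : Prog
  /-- `r_i := max (r_j - r_k, 0)` -/
  | sub (i j k : ℕ) : Prog
  /-- `r_i := M[r_j]` -/
  | load (i j : ℕ) : Prog
  /-- `M[r_i] := r_j` -/
  | store (i j : ℕ) : Prog
  /-- first one program, then another -/
  | seq (P Q : Prog) : Prog
  /-- if `r_i ≠ 0` then the first program, else the second -/
  | ite (i : ℕ) (P Q : Prog) : Prog
  /-- while `r_i ≠ 0`, run the program -/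
  | loop (i : ℕ) (P : Prog) : Prog

/-- The length of the binary representation of `x`, where `0` has length `1`. -/
def len (x : ℕ) : ℕ := Nat.log 2 x + 1

/-- `Exec P s s' t`: the program `P`, started in the configuration `s`, halts in the configuration
`s'` after time `t`. Time is measured with logarithmic cost: every executed operation and every
evaluated test is charged the total binary length of the operands and memory addresses it uses. -/
inductive Exec : Prog → State → State → ℕ → Prop where
  | skip (s : State) : Exec .skip s s 1
  | const (s : State) (i k : ℕ) : Exec (.const i k) s (s.setReg i k) (len k)
  | add (s : State) (i j k : ℕ) :
      Exec (.add i j k) s (s.setReg i (s.reg j + s.reg k)) (len (s.reg j) + len (s.reg k))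
  | sub (s : State) (i j k : ℕ) :
      Exec (.sub i j k) s (s.setReg i (s.reg j - s.reg k)) (len (s.reg j) + len (s.reg k))
  | load (s : State) (i j : ℕ) :
      Exec (.load i j) s (s.setReg i (s.mem (s.reg j)))
        (len (s.reg j) + len (s.mem (s.reg j)))
  | store (s : State) (i j : ℕ) :
      Exec (.store i j) s (s.setMem (s.reg i) (s.reg j)) (len (s.reg i) + len (s.reg j))
  | seq {P Q : Prog} {s s' s'' : State} {t t' : ℕ} (hP : Exec P s s' t) (hQ : Exec Q s' s'' t') :
      Exec (.seq P Q) s s'' (t + t')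
  | ite_pos {i : ℕ} {P Q : Prog} {s s' : State} {t : ℕ} (hi : s.reg i ≠ 0) (hP : Exec P s s' t) :
      Exec (.ite i P Q) s s' (len (s.reg i) + t)
  | ite_zero {i : ℕ} {P Q : Prog} {s s' : State} {t : ℕ} (hi : s.reg i = 0) (hQ : Exec Q s s' t) :
      Exec (.ite i P Q) s s' (len (s.reg i) + t)
  | loop_pos {i : ℕ} {P : Prog} {s s' s'' : State} {t t' : ℕ} (hi : s.reg i ≠ 0)
      (hP : Exec P s s' t) (hL : Exec (.loop i P) s' s'' t') :
      Exec (.loop i P) s s'' (len (s.reg i) + t + t')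
  | loop_zero {i : ℕ} {P : Prog} {s : State} (hi : s.reg i = 0) :
      Exec (.loop i P) s s (len (s.reg i))

/-- The machine is deterministic: final configuration and running time are determined by the
program and the initial configuration. -/
theorem Exec.deterministic {P : Prog} {s s₁ s₂ : State} {t₁ t₂ : ℕ}
    (h₁ : Exec P s s₁ t₁) (h₂ : Exec P s s₂ t₂) : s₁ = s₂ ∧ t₁ = t₂ := by
  induction h₁ generalizing s₂ t₂ with
  | skip | const | add | sub | load | store => cases h₂; exact ⟨rfl, rfl⟩
  | seq _ _ ihP ihQ =>
    cases h₂ with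
    | seq a b =>
      obtain ⟨rfl, rfl⟩ := ihP a
      obtain ⟨rfl, rfl⟩ := ihQ b
      exact ⟨rfl, rfl⟩
  | ite_pos hi _ ih =>
    cases h₂ with
    | ite_pos _ a => obtain ⟨rfl, rfl⟩ := ih a; exact ⟨rfl, rfl⟩
    | ite_zero h _ => exact absurd h hi
  | ite_zero hi _ ih =>
    cases h₂ with
    | ite_pos h _ => exact absurd hi h
    | ite_zero _ a => obtain ⟨rfl, rfl⟩ := ih a; exact ⟨rfl, rfl⟩
  | loop_pos hi _ _ ihP ihL =>
    cases h₂ with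
    | loop_pos _ a b =>
      obtain ⟨rfl, rfl⟩ := ihP a
      obtain ⟨rfl, rfl⟩ := ihL b
      exact ⟨rfl, rfl⟩
    | loop_zero h => exact absurd h hi
  | loop_zero hi =>
    cases h₂ with
    | loop_pos h _ _ => exact absurd hi h
    | loop_zero _ => exact ⟨rfl, rfl⟩

end RAM

/-- The multiplication table of a group whose elements are numbered `0, …, n - 1` by `e`: the
number of the product of the elements with numbers `i` and `j`. -/
def mulTable {G : Type*} [Group G] {n : ℕ} (e : G ≃ Fin n) (i j : Fin n) : Fin n :=
  e (e.symm i * e.symm j)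

/-- The initial configuration for two `n` by `n` tables: all registers are `0`; memory cell `0`
holds `n`, the next `n ^ 2` cells hold the first table row by row, the next `n ^ 2` cells the second
table row by row, and all other cells hold `0`. -/
def tablesInput {n : ℕ} (S T : Fin n → Fin n → Fin n) : RAM.State where
  reg := fun _ => 0
  mem := fun a =>
    ((n :: (List.ofFn fun i => List.ofFn fun j => (S i j : ℕ)).flatten)
      ++ (List.ofFn fun i => List.ofFn fun j => (T i j : ℕ)).flatten).getD a 0

/-! ### Frame rule and word lengths. -/

namespace RAM

/-! Adjoining an element outside a subgroup multiplies its order by a divisor of $n$ that is at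
least $2$, hence by at least $p$ (`Large.extend`). So about $\log_p n$ generators suffice, and
guessing all their images would cost $n^{\log_p n}$ rounds. Meeting in the middle halves the
exponent. With $m$ about $\frac12\log_p n$, lists in $G$ use $m$ generators fixed greedily by the
numbering and then $m$ guessed ones (`listA`); lists in $H$ use $m$ guessed generators and then $m$
greedy ones (`listB`). Each generator is adjoined by appending products in an order that depends
only on positions and equality, so an isomorphism carries such a construction to the same
construction for the image generators.

Given an isomorphism, some guess in $H$ is the image of the greedy half from $G$, and some guess in
$G$ is the preimage of the greedy continuation in $H$; the two lists then correspond. Complete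
corresponding lists have the same multiplication table by positions, and equal tables give an
isomorphism back (`nonempty_mulEquiv_iff`). The guessed halves range over $n^m$ tuples on either
side, independently of each other.

The collision is found without sorting: the table is coded as one number, which serves as a memory
address. Phase one marks the codes from $G$, phase two looks up those from $H$ (`searchProg_spec`).
Such an address has polynomially many binary digits, so the logarithmic cost of a round remains
polynomial in $n$.

For the cost, `Runs` couples running time with growth of word length. This is too lossy for $n^m$
rounds, so each round ends by restoring a fixed word length, and `forDown_exec` adds up the round
costs linearly. Finally $m = j + 1$ with $j$ minimal such that $n \le p^{2j}$, and all polynomial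
factors are absorbed into $C$. -/

@[simp] theorem State.reg_setReg (s : State) (i v j : ℕ) :
    (s.setReg i v).reg j = if j = i then v else s.reg j := by
  simp [State.setReg, Function.update_apply]

@[simp] theorem State.mem_setReg (s : State) (i v : ℕ) : (s.setReg i v).mem = s.mem := rfl

@[simp] theorem State.reg_setMem (s : State) (a v : ℕ) : (s.setMem a v).reg = s.reg := rfl

@[simp] theorem State.mem_setMem (s : State) (a v b : ℕ) :
    (s.setMem a v).mem b = if b = a then v else s.mem b := by
  simp [State.setMem, Function.update_apply]

/-- The registers that a program may write. -/
def Prog.wr : Prog → List ℕ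
  | .skip => []
  | .const i _ => [i]
  | .add i _ _ => [i]
  | .sub i _ _ => [i]
  | .load i _ => [i]
  | .store _ _ => []
  | .seq P Q => P.wr ++ Q.wr
  | .ite _ P Q => P.wr ++ Q.wr
  | .loop _ P => P.wr

theorem Exec.frame {P : Prog} {s s' : State} {t : ℕ} (h : Exec P s s' t) :
    ∀ i, i ∉ P.wr → s'.reg i = s.reg i := by
  induction h with
  | skip | store => intro i _; rfl
  | const | add | sub | load =>
    intro i hi
    simp only [Prog.wr, List.mem_singleton] at hi
    simp [hi]
  | seq _ _ ihP ihQ =>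
    intro i hi
    simp only [Prog.wr, List.mem_append, not_or] at hi
    rw [ihQ i hi.2, ihP i hi.1]
  | ite_pos _ _ ih =>
    intro i hi
    simp only [Prog.wr, List.mem_append, not_or] at hi
    exact ih i hi.1
  | ite_zero _ _ ih =>
    intro i hi
    simp only [Prog.wr, List.mem_append, not_or] at hi
    exact ih i hi.2
  | loop_pos _ _ _ ihP ihL =>
    intro i hi
    rw [ihL i hi, ihP i hi]
  | loop_zero => intro i _; rfl

/-- All values in a configuration have at most `w` binary digits. -/
def State.Bounded (w : ℕ) (s : State) : Prop :=
  (∀ i, s.reg i < 2 ^ w) ∧ ∀ a, s.mem a < 2 ^ w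

theorem State.Bounded.mono {w w' : ℕ} {s : State} (h : s.Bounded w) (hw : w ≤ w') :
    s.Bounded w' :=
  ⟨fun i => (h.1 i).trans_le (Nat.pow_le_pow_right two_pos hw),
    fun a => (h.2 a).trans_le (Nat.pow_le_pow_right two_pos hw)⟩

theorem State.Bounded.setReg {w i v : ℕ} {s : State} (h : s.Bounded w) (hv : v < 2 ^ w) :
    (s.setReg i v).Bounded w := by
  refine ⟨fun j => ?_, h.2⟩
  rw [State.reg_setReg]
  split_ifs
  exacts [hv, h.1 j]

theorem State.Bounded.setMem {w a v : ℕ} {s : State} (h : s.Bounded w) (hv : v < 2 ^ w) :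
    (s.setMem a v).Bounded w := by
  refine ⟨h.1, fun j => ?_⟩
  rw [State.mem_setMem]
  split_ifs
  exacts [hv, h.2 j]

theorem len_le {x w : ℕ} (h : x < 2 ^ w) : len x ≤ w + 1 := by
  unfold len
  rcases Nat.eq_zero_or_pos x with rfl | hx
  · simp
  · have := Nat.log_lt_of_lt_pow hx.ne' h
    omega

theorem lt_two_pow_len (k : ℕ) : k < 2 ^ len k := Nat.lt_pow_succ_log_self one_lt_two k

/-! ### Unit steps: a compositional bound for growth and cost. -/

/-- `P` leads from `s` to `s'` in `u` unit steps: this bounds the growth of the values and the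
logarithmic cost. -/
def Runs (P : Prog) (s s' : State) (u : ℕ) : Prop :=
  ∃ t, Exec P s s' t ∧ ∀ w, s.Bounded w → s'.Bounded (w + u) ∧ t ≤ 2 * u * (w + u)

theorem Runs.frame {P : Prog} {s s' : State} {u : ℕ} (h : Runs P s s' u) {i : ℕ}
    (hi : i ∉ P.wr) : s'.reg i = s.reg i :=
  let ⟨_, h, _⟩ := h
  h.frame i hi

theorem Runs.mono {P : Prog} {s s' : State} {u u' : ℕ} (h : Runs P s s' u) (hu : u ≤ u') :
    Runs P s s' u' := by
  obtain ⟨t, h, hb⟩ := h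
  refine ⟨t, h, fun w hw => ⟨(hb w hw).1.mono (by omega), (hb w hw).2.trans ?_⟩⟩
  gcongr

theorem Runs.skip (s : State) : Runs .skip s s 1 :=
  ⟨1, .skip s, fun w hw => ⟨hw.mono (by omega), by omega⟩⟩

/-- A constant can raise the word length to `len k` at once, so it is charged that many unit steps;
every other instruction adds at most one bit. -/
theorem Runs.const (s : State) (i k : ℕ) : Runs (.const i k) s (s.setReg i k) (len k) := by
  refine ⟨_, .const s i k, fun w hw => ⟨(hw.mono (by omega)).setReg ?_, ?_⟩⟩
  · exact (lt_two_pow_len k).trans_le (Nat.pow_le_pow_right two_pos (by omega))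
  · have : 1 ≤ len k := Nat.le_add_left _ _
    nlinarith

theorem Runs.add (s : State) (i j k : ℕ) :
    Runs (.add i j k) s (s.setReg i (s.reg j + s.reg k)) 1 := by
  refine ⟨_, .add s i j k, fun w hw => ⟨(hw.mono (by omega)).setReg ?_, ?_⟩⟩
  · have := hw.1 j
    have := hw.1 k
    rw [pow_succ]; omega
  · have := len_le (hw.1 j)
    have := len_le (hw.1 k)
    omega

theorem Runs.sub (s : State) (i j k : ℕ) :
    Runs (.sub i j k) s (s.setReg i (s.reg j - s.reg k)) 1 := by
  refine ⟨_, .sub s i j k, fun w hw => ⟨(hw.mono (by omega)).setReg ?_, ?_⟩⟩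
  · have := hw.1 j
    rw [pow_succ]; omega
  · have := len_le (hw.1 j)
    have := len_le (hw.1 k)
    omega

theorem Runs.load (s : State) (i j : ℕ) :
    Runs (.load i j) s (s.setReg i (s.mem (s.reg j))) 1 := by
  refine ⟨_, .load s i j, fun w hw => ⟨(hw.mono (by omega)).setReg ?_, ?_⟩⟩
  · have := hw.2 (s.reg j)
    rw [pow_succ]; omega
  · have := len_le (hw.1 j)
    have := len_le (hw.2 (s.reg j))
    omega

theorem Runs.store (s : State) (i j : ℕ) :
    Runs (.store i j) s (s.setMem (s.reg i) (s.reg j)) 1 := by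
  refine ⟨_, .store s i j, fun w hw => ⟨(hw.mono (by omega)).setMem ?_, ?_⟩⟩
  · have := hw.1 j
    rw [pow_succ]; omega
  · have := len_le (hw.1 i)
    have := len_le (hw.1 j)
    omega

/-- The second program starts with word length `w + u`, and $2u(w+u) + 2v(w+u+v) \le 2(u+v)(w+u+v)$;
the quadratic form of the bound in `Runs` is what makes it closed under sequencing. -/
theorem Runs.seq {P Q : Prog} {s s' s'' : State} {u v : ℕ} (hP : Runs P s s' u)
    (hQ : Runs Q s' s'' v) : Runs (.seq P Q) s s'' (u + v) := by
  obtain ⟨t, hP, hbP⟩ := hP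
  obtain ⟨t', hQ, hbQ⟩ := hQ
  refine ⟨_, .seq hP hQ, fun w hw => ?_⟩
  obtain ⟨h1, h2⟩ := hbP w hw
  obtain ⟨h3, h4⟩ := hbQ _ h1
  refine ⟨h3.mono (by omega), ?_⟩
  nlinarith

theorem Runs.ite_pos {i : ℕ} {P Q : Prog} {s s' : State} {u : ℕ} (hi : s.reg i ≠ 0)
    (hP : Runs P s s' u) : Runs (.ite i P Q) s s' (u + 1) := by
  obtain ⟨t, hP, hb⟩ := hP
  refine ⟨_, .ite_pos hi hP, fun w hw => ?_⟩
  obtain ⟨h1, h2⟩ := hb w hw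
  refine ⟨h1.mono (by omega), ?_⟩
  have := len_le (hw.1 i)
  nlinarith

theorem Runs.ite_zero {i : ℕ} {P Q : Prog} {s s' : State} {u : ℕ} (hi : s.reg i = 0)
    (hQ : Runs Q s s' u) : Runs (.ite i P Q) s s' (u + 1) := by
  obtain ⟨t, hQ, hb⟩ := hQ
  refine ⟨_, .ite_zero hi hQ, fun w hw => ?_⟩
  obtain ⟨h1, h2⟩ := hb w hw
  refine ⟨h1.mono (by omega), ?_⟩
  have := len_le (hw.1 i)
  nlinarith

theorem Runs.loop_pos {i : ℕ} {P : Prog} {s s' s'' : State} {u v : ℕ} (hi : s.reg i ≠ 0)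
    (hP : Runs P s s' u) (hL : Runs (.loop i P) s' s'' v) :
    Runs (.loop i P) s s'' (u + v + 1) := by
  obtain ⟨t, hP, hbP⟩ := hP
  obtain ⟨t', hL, hbL⟩ := hL
  refine ⟨_, .loop_pos hi hP hL, fun w hw => ?_⟩
  obtain ⟨h1, h2⟩ := hbP w hw
  obtain ⟨h3, h4⟩ := hbL _ h1
  refine ⟨h3.mono (by omega), ?_⟩
  have := len_le (hw.1 i)
  nlinarith

theorem Runs.loop_zero {i : ℕ} {P : Prog} {s : State} (hi : s.reg i = 0) :
    Runs (.loop i P) s s 1 := by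
  refine ⟨_, .loop_zero hi, fun w hw => ⟨hw.mono (by omega), ?_⟩⟩
  have := len_le (hw.1 i)
  omega

/-! ### Straight-line code and counting loops. -/

/-- The effect of a single instruction. -/
def Prog.step : Prog → State → State
  | .const i k, s => s.setReg i k
  | .add i j k, s => s.setReg i (s.reg j + s.reg k)
  | .sub i j k, s => s.setReg i (s.reg j - s.reg k)
  | .load i j, s => s.setReg i (s.mem (s.reg j))
  | .store i j, s => s.setMem (s.reg i) (s.reg j)
  | _, s => s

/-- The number of unit steps of a single instruction. -/
def Prog.stepCost : Prog → ℕ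
  | .const _ k => len k
  | _ => 1

/-- Is the program a single instruction? -/
def Prog.isInstr : Prog → Bool
  | .seq _ _ | .ite _ _ _ | .loop _ _ => false
  | _ => true

/-- Straight-line code. -/
def block : List Prog → Prog
  | [] => .skip
  | P :: l => .seq P (block l)

/-- The effect of straight-line code. -/
def blockStep : List Prog → State → State
  | [], s => s
  | P :: l, s => blockStep l (P.step s)

/-- The number of unit steps of straight-line code. -/
def blockCost : List Prog → ℕ
  | [] => 1
  | P :: l => P.stepCost + blockCost l

theorem Runs.instr {P : Prog} (hP : P.isInstr = true) (s : State) :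
    Runs P s (P.step s) P.stepCost := by
  cases P with
  | skip => exact .skip s
  | const => exact .const ..
  | add => exact .add ..
  | sub => exact .sub ..
  | load => exact .load ..
  | store => exact .store ..
  | seq | ite | loop => cases hP

theorem Runs.block {l : List Prog} (hl : l.all Prog.isInstr = true) (s : State) :
    Runs (block l) s (blockStep l s) (blockCost l) := by
  induction l generalizing s with
  | nil => exact .skip s
  | cons P l ih =>
    simp only [List.all_cons, Bool.and_eq_true] at hl
    exact (Runs.instr hl.1 s).seq (ih hl.2 _)

/-- `desc f K a` applies `f (K - 1)`, …, `f 0` to `a`, in this order. -/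
def desc {α : Type*} (f : ℕ → α → α) : ℕ → α → α
  | 0, a => a
  | k + 1, a => desc f k (f k a)

/-- Count register `c` down to `0`, running `P` with the values below the initial one.
Register `1` has to hold `1`. -/
def forDown (c : ℕ) (P : Prog) : Prog := .loop c (.seq (.sub c c 1) P)

/-- The rule for loops, with an invariant that depends on the number of remaining rounds. -/
theorem forDown_inv {c : ℕ} {P : Prog} (Inv : ℕ → State → Prop)
    (u : ℕ) {s₀ : State} (hc : c ∉ P.wr) (h1 : 1 ∉ P.wr) (hc1 : c ≠ 1)
    (hone : s₀.reg 1 = 1) (h₀ : Inv (s₀.reg c) s₀)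
    (hset : ∀ k s v, Inv k s → Inv k (s.setReg c v))
    (hbody : ∀ k s, k < s₀.reg c → Inv (k + 1) s → s.reg c = k →
      (∀ i, i ∉ P.wr → i ≠ c → s.reg i = s₀.reg i) → ∃ s', Runs P s s' u ∧ Inv k s') :
    ∃ s', Runs (forDown c P) s₀ s' (s₀.reg c * (u + 2) + 1) ∧ Inv 0 s' := by
  suffices H : ∀ K s, K ≤ s₀.reg c → Inv K s → s.reg c = K →
      (∀ i, i ∉ P.wr → i ≠ c → s.reg i = s₀.reg i) →
      ∃ s', Runs (forDown c P) s s' (K * (u + 2) + 1) ∧ Inv 0 s' from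
    H _ _ le_rfl h₀ rfl fun _ _ _ => rfl
  intro K
  induction K with
  | zero =>
    intro s _ ha hs _
    exact ⟨s, (Runs.loop_zero hs).mono (by omega), ha⟩
  | succ K ih =>
    intro s hK ha hs hfr
    have e1 : s.reg 1 = 1 := by rw [hfr 1 h1 hc1.symm, hone]
    have hsub := Runs.sub s c c 1
    rw [hs, e1, Nat.add_sub_cancel] at hsub
    obtain ⟨s1, hr, hrel⟩ := hbody K (s.setReg c K) (by omega) (hset _ _ _ ha) (by simp)
      (fun i hi hic => by simp [hic, hfr i hi hic])
    obtain ⟨s2, hr2, hrel2⟩ := ih s1 (by omega) hrel (by rw [hr.frame hc]; simp)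
      (fun i hi hic => by rw [hr.frame hi]; simp [hic, hfr i hi hic])
    refine ⟨s2, (Runs.loop_pos (by omega) (hsub.seq hr) hr2).mono ?_, hrel2⟩
    ring_nf; omega

/-- The rule for loops, with an abstract description of the loop. -/
theorem forDown_spec {α : Type*} {c : ℕ} {P : Prog} (Rel : α → State → Prop) (f : ℕ → α → α)
    (u : ℕ) {s₀ : State} {a₀ : α} (hc : c ∉ P.wr) (h1 : 1 ∉ P.wr) (hc1 : c ≠ 1)
    (hone : s₀.reg 1 = 1) (h₀ : Rel a₀ s₀)
    (hset : ∀ a s k, Rel a s → Rel a (s.setReg c k))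
    (hbody : ∀ k a s, k < s₀.reg c → Rel a s → s.reg c = k →
      (∀ i, i ∉ P.wr → i ≠ c → s.reg i = s₀.reg i) → ∃ s', Runs P s s' u ∧ Rel (f k a) s') :
    ∃ s', Runs (forDown c P) s₀ s' (s₀.reg c * (u + 2) + 1) ∧ Rel (desc f (s₀.reg c) a₀) s' := by
  obtain ⟨s', h, a, ha, hs'⟩ := forDown_inv
    (fun k s => ∃ a, desc f (s₀.reg c) a₀ = desc f k a ∧ Rel a s) u hc h1 hc1 hone
    ⟨a₀, rfl, h₀⟩ (fun k s v ⟨a, ha, hs⟩ => ⟨a, ha, hset _ _ _ hs⟩)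
    (fun k s hk ⟨a, ha, hs⟩ hsc hfr =>
      let ⟨s', h, hs'⟩ := hbody k a s hk hs hsc hfr
      ⟨s', h, f k a, ha, hs'⟩)
  exact ⟨s', h, ha ▸ hs'⟩

/-- A long loop whose body restores a bound on all values. -/
theorem forDown_exec {c : ℕ} {P : Prog} (Inv : ℕ → State → Prop)
    (u w : ℕ) {s₀ : State} (hc : c ∉ P.wr) (h1 : 1 ∉ P.wr) (hc1 : c ≠ 1)
    (hone : s₀.reg 1 = 1) (h₀ : Inv (s₀.reg c) s₀)
    (hset : ∀ k s, Inv (k + 1) s → Inv (k + 1) (s.setReg c k))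
    (hbd : ∀ k s, Inv k s → s.Bounded w)
    (hbody : ∀ k s, k < s₀.reg c → Inv (k + 1) s → s.reg c = k →
      (∀ i, i ∉ P.wr → i ≠ c → s.reg i = s₀.reg i) → ∃ s', Runs P s s' u ∧ Inv k s') :
    ∃ s' t, Exec (forDown c P) s₀ s' t ∧ Inv 0 s' ∧
      t ≤ (s₀.reg c + 1) * (2 * (u + 2) * (w + u + 2)) := by
  suffices H : ∀ K s, K ≤ s₀.reg c → Inv K s → s.reg c = K →
      (∀ i, i ∉ P.wr → i ≠ c → s.reg i = s₀.reg i) →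
      ∃ s' t, Exec (forDown c P) s s' t ∧ Inv 0 s' ∧
        t ≤ (K + 1) * (2 * (u + 2) * (w + u + 2)) from
    H _ _ le_rfl h₀ rfl fun _ _ _ => rfl
  intro K
  induction K with
  | zero =>
    intro s _ ha hs _
    refine ⟨s, _, .loop_zero hs, ha, ?_⟩
    have := len_le ((hbd _ _ ha).1 c)
    nlinarith
  | succ K ih =>
    intro s hK ha hs hfr
    have e1 : s.reg 1 = 1 := by rw [hfr 1 h1 hc1.symm, hone]
    have hsub := Runs.sub s c c 1
    rw [hs, e1, Nat.add_sub_cancel] at hsub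
    obtain ⟨s1, hr, hrel⟩ := hbody K (s.setReg c K) (by omega) (hset _ _ ha) (by simp)
      (fun i hi hic => by simp [hic, hfr i hi hic])
    obtain ⟨s2, t2, hr2, hrel2, ht2⟩ := ih s1 (by omega) hrel (by rw [hr.frame hc]; simp)
      (fun i hi hic => by rw [hr.frame hi]; simp [hic, hfr i hi hic])
    obtain ⟨t1, hx, hb⟩ := hsub.seq hr
    refine ⟨s2, _, .loop_pos (by omega) hx hr2, hrel2, ?_⟩
    -- Every round is measured from the same word length `w`, supplied by the invariant and not by
    -- the growth in earlier rounds; hence the total is linear in the number of rounds.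
    have h3 := (hb w (hbd _ _ ha)).2
    have h4 := len_le ((hbd _ _ ha).1 c)
    nlinarith

/-! ### Downward iteration and Horner codes. -/

section Desc

variable {α β : Type*}

theorem desc_induct {f : ℕ → α → α} {p : α → Prop} {K : ℕ} (hf : ∀ k < K, ∀ a, p a → p (f k a))
    {a : α} (ha : p a) : p (desc f K a) := by
  induction K generalizing a with
  | zero => exact ha
  | succ K ih => exact ih (fun k hk => hf k (by omega)) (hf K (by omega) a ha)

/-- Step `k` establishes `q k`, and the later steps preserve it by `hmono`. -/
theorem desc_forall {f : ℕ → α → α} {p : α → Prop} {q : ℕ → α → Prop} {K : ℕ}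
    (hp : ∀ k a, p a → p (f k a)) (hq : ∀ k a, p a → q k (f k a))
    (hmono : ∀ j k a, q j a → q j (f k a)) {a : α} (ha : p a) :
    ∀ k < K, q k (desc f K a) := by
  induction K generalizing a with
  | zero => simp
  | succ K ih =>
    intro k hk
    rcases Nat.lt_succ_iff_lt_or_eq.1 hk with h | rfl
    · exact ih (hp _ _ ha) k h
    · exact desc_induct (p := q k) (K := k) (fun j _ a => hmono _ j a) (hq _ _ ha)

theorem desc_congr {f g : ℕ → α → α} {K : ℕ} (h : ∀ k < K, f k = g k) (a : α) :
    desc f K a = desc g K a := by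
  induction K generalizing a with
  | zero => rfl
  | succ K ih =>
    simp only [desc, h K (by omega)]
    exact ih (fun k hk => h k (by omega)) _

theorem map_desc {f : ℕ → α → α} {g : ℕ → β → β} (φ : α → β)
    (h : ∀ k a, φ (f k a) = g k (φ a)) (K : ℕ) (a : α) :
    φ (desc f K a) = desc g K (φ a) := by
  induction K generalizing a with
  | zero => rfl
  | succ K ih => simp only [desc, ih, h]

/-- Recording the adaptive choices made along one run turns it into a run with a prescribed
sequence. This is how greedy generators become guessable ones. -/
theorem exists_desc_eq (f : β → α → α) (g : α → β) (K : ℕ) (a : α) :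
    ∃ x : ℕ → β, desc (fun _ b => f (g b) b) K a = desc (fun k => f (x k)) K a := by
  induction K generalizing a with
  | zero => exact ⟨fun _ => g a, rfl⟩
  | succ K ih =>
    obtain ⟨x, hx⟩ := ih (f (g a) a)
    refine ⟨fun k => if k = K then g a else x k, ?_⟩
    simp only [desc, if_true, hx]
    exact desc_congr (fun k hk => by simp [hk.ne]) _

/-- The iteration is Horner's scheme in base `b`, with `x 0` as lowest digit; reduction modulo `b`
strips off the digits one by one. -/
theorem desc_horner_inj {b : ℕ} {x y : ℕ → ℕ} {K c c' : ℕ} (hx : ∀ k < K, x k < b)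
    (hy : ∀ k < K, y k < b)
    (h : desc (fun k a => b * a + x k) K c = desc (fun k a => b * a + y k) K c') :
    c = c' ∧ ∀ k < K, x k = y k := by
  induction K generalizing c c' with
  | zero => exact ⟨h, by simp⟩
  | succ K ih =>
    obtain ⟨h1, h2⟩ := ih (fun k hk => hx k (by omega)) (fun k hk => hy k (by omega)) h
    have hxK := hx K (by omega)
    have hyK := hy K (by omega)
    have h3 : x K = y K := by
      have := congrArg (· % b) h1
      simpa [Nat.mul_add_mod, Nat.mod_eq_of_lt hxK, Nat.mod_eq_of_lt hyK] using this
    refine ⟨?_, fun k hk => ?_⟩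
    · simp only [h3, Nat.add_right_cancel_iff] at h1
      exact Nat.eq_of_mul_eq_mul_left (by omega) h1
    · rcases Nat.lt_succ_iff_lt_or_eq.1 hk with h | rfl
      exacts [h2 k h, h3]

theorem desc_desc_horner_inj {b : ℕ} {x y : ℕ → ℕ → ℕ} {K M c c' : ℕ}
    (hx : ∀ i < K, ∀ j < M, x i j < b) (hy : ∀ i < K, ∀ j < M, y i j < b)
    (h : desc (fun i => desc (fun j a => b * a + x i j) M) K c =
      desc (fun i => desc (fun j a => b * a + y i j) M) K c') :
    c = c' ∧ ∀ i < K, ∀ j < M, x i j = y i j := by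
  induction K generalizing c c' with
  | zero => exact ⟨h, by simp⟩
  | succ K ih =>
    obtain ⟨h1, h2⟩ := ih (fun k hk => hx k (by omega)) (fun k hk => hy k (by omega)) h
    obtain ⟨h3, h4⟩ := desc_horner_inj (hx K (by omega)) (hy K (by omega)) h1
    refine ⟨h3, fun k hk => ?_⟩
    rcases Nat.lt_succ_iff_lt_or_eq.1 hk with h | rfl
    exacts [h2 k h, h4]

end Desc

/-! ### Closing a list under products, with positions kept. -/

section Closure

set_option linter.unusedSectionVars false

variable {G H : Type*} [Group G] [DecidableEq G] [Group H] [DecidableEq H]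

/-- Append an element unless it is there already. -/
def ins (l : List G) (g : G) : List G := if g ∈ l then l else l ++ [g]

/-- Append the product of the entries at `i` and `j`. -/
def insMul (i j : ℕ) (l : List G) : List G := ins l (l.getD i 1 * l.getD j 1)

/-- Append all products of two entries. -/
def insAll (l : List G) : List G :=
  desc (fun i l => desc (insMul i) l.length l) l.length l

/-- Append `g`, and then products, in `n` rounds. -/
def extend (n : ℕ) (g : G) (l : List G) : List G := desc (fun _ => insAll) n (ins l g)

theorem prefix_ins (l : List G) (g : G) : l <+: ins l g := by
  unfold ins; split_ifs
  exacts [List.prefix_refl _, List.prefix_append _ _]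

theorem mem_ins (l : List G) (g : G) : g ∈ ins l g := by
  unfold ins; split_ifs with h <;> simp [h]

theorem nodup_ins {l : List G} (h : l.Nodup) (g : G) : (ins l g).Nodup := by
  unfold ins; split_ifs with hg
  · exact h
  · rw [← List.concat_eq_append]; exact h.concat hg

theorem prefix_desc_insMul {l₀ l : List G} (h : l₀ <+: l) (i K : ℕ) :
    l₀ <+: desc (insMul i) K l :=
  desc_induct (p := (l₀ <+: ·)) (fun _ _ _ h => h.trans (prefix_ins _ _)) h

theorem prefix_insAll (l : List G) : l <+: insAll l :=
  desc_induct (p := (l <+: ·)) (fun _ _ _ h => prefix_desc_insMul h _ _) (List.prefix_refl l)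

theorem nodup_insAll {l : List G} (h : l.Nodup) : (insAll l).Nodup :=
  desc_induct (p := List.Nodup)
    (fun _ _ _ h => desc_induct (p := List.Nodup) (fun _ _ _ h => nodup_ins h _) h) h

theorem prefix_desc_insAll (l : List G) (n : ℕ) : l <+: desc (fun _ => insAll) n l :=
  desc_induct (p := (l <+: ·)) (fun _ _ _ h => h.trans (prefix_insAll _)) (List.prefix_refl l)

theorem nodup_extend {l : List G} (h : l.Nodup) (n : ℕ) (g : G) : (extend n g l).Nodup :=
  desc_induct (p := List.Nodup) (fun _ _ _ h => nodup_insAll h) (nodup_ins h g)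

theorem prefix_extend (l : List G) (n : ℕ) (g : G) : l <+: extend n g l :=
  (prefix_ins l g).trans (prefix_desc_insAll _ n)

theorem mem_extend (l : List G) (n : ℕ) (g : G) : g ∈ extend n g l :=
  (prefix_desc_insAll _ n).subset (mem_ins l g)

theorem getD_of_prefix {l l' : List G} (h : l <+: l') {i : ℕ} (hi : i < l.length) :
    l'.getD i 1 = l.getD i 1 := by
  obtain ⟨r, rfl⟩ := h
  rw [List.getD_append _ _ _ _ hi]

/-- Entries never move and the loop bounds are at least the original length, so every pair of
original positions is visited with its original entries, whatever has been appended meanwhile. -/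
theorem mul_mem_insAll {l : List G} {a b : G} (ha : a ∈ l) (hb : b ∈ l) : a * b ∈ insAll l := by
  obtain ⟨i, hi, rfl⟩ := List.getElem_of_mem ha
  obtain ⟨j, hj, rfl⟩ := List.getElem_of_mem hb
  rw [← List.getD_eq_getElem l 1 hi, ← List.getD_eq_getElem l 1 hj]
  refine desc_forall (p := (l <+: ·))
    (q := fun i l' => i < l.length → l.getD i 1 * l.getD j 1 ∈ l')
    (fun k a h => prefix_desc_insMul h _ _) ?_ ?_ (List.prefix_refl l) i hi hi
  · intro k l' hl hk
    refine desc_forall (p := (l <+: ·))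
      (q := fun j l' => j < l.length → l.getD k 1 * l.getD j 1 ∈ l')
      (fun _ a h => h.trans (prefix_ins _ _)) ?_ ?_ hl j (hj.trans_le hl.length_le) hj
    · intro j l' hl hj
      have := mem_ins l' (l'.getD k 1 * l'.getD j 1)
      change _ ∈ ins l' (l'.getD k 1 * l'.getD j 1)
      rwa [getD_of_prefix hl hk, getD_of_prefix hl hj] at this ⊢
    · intro _ _ _ h h'
      exact (prefix_ins _ _).subset (h h')
  · intro _ _ l' h h'
    exact (prefix_desc_insMul (List.prefix_refl l') _ _).subset (h h')

/-- A round that appends nothing stops all growth. Otherwise each of the rounds lengthens the list,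
and a duplicate-free list would exceed the order of the group. -/
theorem insAll_desc_insAll [Fintype G] {l : List G} (hl : l ≠ []) (hd : l.Nodup) :
    insAll (desc (fun _ => insAll) (Fintype.card G) l) =
      desc (fun _ => insAll) (Fintype.card G) l := by
  have H : ∀ K (l : List G), l.Nodup →
      insAll (desc (fun _ => insAll) K l) = desc (fun _ => insAll) K l ∨
      l.length + K < (insAll (desc (fun _ => insAll) K l)).length := by
    intro K
    induction K with
    | zero =>
      intro l hd
      have h := prefix_insAll l
      rcases h.length_le.eq_or_lt with h' | h'
      · exact .inl (h.eq_of_length h').symm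
      · exact .inr (by simpa [desc] using h')
    | succ K ih =>
      intro l hd
      rcases ih _ (nodup_insAll hd) with h | h
      · exact .inl h
      · have h1 := prefix_insAll l
        rcases h1.length_le.eq_or_lt with h' | h'
        · have h2 : insAll l = l := (h1.eq_of_length h').symm
          have h3 : ∀ K, desc (fun _ => insAll) K l = l := fun K =>
            desc_induct (p := (· = l)) (fun _ _ a h => by rw [h, h2]) rfl
          left
          rw [h3, h2]
        · right
          simp only [desc]
          omega
  rcases H (Fintype.card G) l hd with h | h
  · exact h
  · have h1 : (insAll (desc (fun _ => insAll) (Fintype.card G) l)).Nodup :=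
      nodup_insAll (desc_induct (p := List.Nodup) (fun _ _ _ h => nodup_insAll h) hd)
    have h2 := h1.length_le_card
    have h3 := List.length_pos_of_ne_nil hl
    omega

/-- The entries form a subgroup. -/
def IsSub (l : List G) : Prop := ∃ K : Subgroup G, ∀ x, x ∈ l ↔ x ∈ K

/-- The stable list is closed under products and nonempty; in a finite group the identity and the
inverses are positive powers. -/
theorem isSub_extend [Fintype G] {l : List G} (hd : l.Nodup) (g : G) :
    IsSub (extend (Fintype.card G) g l) := by
  have hne : ins l g ≠ [] := List.ne_nil_of_mem (mem_ins l g)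
  have hfix := insAll_desc_insAll hne (nodup_ins hd g)
  have hmul : ∀ {a b}, a ∈ extend (Fintype.card G) g l → b ∈ extend (Fintype.card G) g l →
      a * b ∈ extend (Fintype.card G) g l := by
    intro a b ha hb
    have := mul_mem_insAll ha hb
    unfold extend at this ⊢
    rwa [hfix] at this
  have hpow : ∀ {a}, a ∈ extend (Fintype.card G) g l → ∀ k,
      a ^ (k + 1) ∈ extend (Fintype.card G) g l := by
    intro a ha k
    induction k with
    | zero => simpa using ha
    | succ k ih => rw [pow_succ]; exact hmul ih ha
  have hone : (1 : G) ∈ extend (Fintype.card G) g l := by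
    have := hpow (mem_extend l (Fintype.card G) g) (Fintype.card G - 1)
    rwa [Nat.sub_add_cancel Fintype.card_pos, pow_card_eq_one] at this
  refine ⟨{ carrier := {x | x ∈ extend (Fintype.card G) g l}, mul_mem' := hmul, one_mem' := hone,
            inv_mem' := fun {a} ha => ?_ }, fun x => Iff.rfl⟩
  -- The exponent is $2|G|-1$ and not $|G|-1$, which would be $0$ for the trivial group.
  have h1 := hpow ha (2 * (Fintype.card G - 1))
  have h2 : a ^ (2 * (Fintype.card G - 1) + 1) = a⁻¹ := by
    rw [eq_inv_iff_mul_eq_one, ← pow_succ,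
      show 2 * (Fintype.card G - 1) + 1 + 1 = Fintype.card G * 2 by
        have := Fintype.card_pos (α := G); omega, pow_mul, pow_card_eq_one, one_pow]
  rwa [h2] at h1

theorem length_eq_card {l : List G} (hd : l.Nodup) {K : Subgroup G} (hK : ∀ x, x ∈ l ↔ x ∈ K) :
    l.length = Nat.card K := by
  rw [← List.toFinset_card_of_nodup hd, ← Nat.card_eq_finsetCard]
  refine Nat.card_congr (Equiv.subtypeEquivRight fun x => ?_)
  simp [hK]

/-- The entries are distinct and form a subgroup of order at least `p ^ k`, or everything. -/
def Large (p k : ℕ) (l : List G) : Prop :=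
  l.Nodup ∧ IsSub l ∧ (p ^ k ≤ l.length ∨ ∀ x, x ∈ l)

/-- By Lagrange the ratio `q` of the two orders divides the order of the group, and it is not $1$
because `g` is new; so it is at least `p`. A list that is already everything stays so. -/
theorem Large.extend [Fintype G] {p k : ℕ} (hp : ∀ q, 2 ≤ q → q ∣ Fintype.card G → p ≤ q)
    {l : List G} (h : Large p k l) {g : G} (hg : g ∉ l ∨ ∀ x, x ∈ l) :
    Large p (k + 1) (extend (Fintype.card G) g l) := by
  obtain ⟨hd, ⟨K, hK⟩, hl⟩ := h
  refine ⟨nodup_extend hd _ _, isSub_extend hd g, ?_⟩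
  have hsub := (prefix_extend l (Fintype.card G) g).subset
  by_cases hfull : ∀ x, x ∈ l
  · exact .inr fun x => hsub (hfull x)
  have hg := hg.resolve_right hfull
  have hl := hl.resolve_right hfull
  left
  obtain ⟨K', hK'⟩ := isSub_extend hd g
  have hle : K ≤ K' := fun x hx => (hK' x).1 (hsub ((hK x).2 hx))
  rw [length_eq_card (nodup_extend hd _ _) hK']
  rw [length_eq_card hd hK] at hl
  obtain ⟨q, hq⟩ := Subgroup.card_dvd_of_le hle
  have hq2 : 2 ≤ q := by
    have hpos : 0 < Nat.card K' := Nat.card_pos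
    by_contra hlt
    have hcases : q = 0 ∨ q = 1 := by omega
    rcases hcases with rfl | rfl
    · omega
    · rw [mul_one] at hq
      have := Subgroup.eq_of_le_of_card_ge hle hq.le
      exact hg ((hK g).2 (this ▸ (hK' g).1 (mem_extend l _ g)))
  have hqd : q ∣ Fintype.card G := by
    rw [← Nat.card_eq_fintype_card]
    exact (Dvd.intro_left _ hq.symm).trans K'.card_subgroup_dvd_card
  rw [hq, pow_succ]
  exact Nat.mul_le_mul hl (hp q hq2 hqd)

/-- The first element adjoined to the empty list may be the identity, so it guarantees order $p^0$
only. This is why each half uses one generator more than the count by powers of `p` suggests. -/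
theorem large_zero_extend [Fintype G] {l : List G} (hd : l.Nodup) (p : ℕ) (g : G) :
    Large p 0 (RAM.extend (Fintype.card G) g l) :=
  ⟨nodup_extend hd _ _, isSub_extend hd g,
    .inl (by rw [pow_zero]; exact List.length_pos_of_mem (mem_extend l _ g))⟩

theorem Large.length_eq [Fintype G] {p k : ℕ} {l : List G} (h : Large p k l)
    (hk : Fintype.card G ≤ p ^ k) : l.length = Fintype.card G := by
  obtain ⟨hd, _, h | h⟩ := h
  · exact le_antisymm hd.length_le_card (hk.trans h)
  · rw [← List.toFinset_card_of_nodup hd, ← Finset.card_univ]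
    congr 1
    ext x
    simp [h x]

/-! ### Isomorphisms -/

/-- Insertion only tests equality, which an isomorphism respects; equivariance of all later
constructions starts here. -/
theorem map_ins (φ : G ≃* H) (l : List G) (g : G) : (ins l g).map φ = ins (l.map φ) (φ g) := by
  unfold ins
  simp only [List.mem_map, EmbeddingLike.apply_eq_iff_eq, exists_eq_right]
  split_ifs <;> simp

theorem getD_map_one (φ : G ≃* H) (l : List G) (i : ℕ) : (l.map φ).getD i 1 = φ (l.getD i 1) := by
  rw [← map_one φ, List.getD_map]

theorem map_insMul (φ : G ≃* H) (i j : ℕ) (l : List G) :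
    (insMul i j l).map φ = insMul i j (l.map φ) := by
  rw [insMul, map_ins, insMul, getD_map_one, getD_map_one, map_mul]

theorem map_insAll (φ : G ≃* H) (l : List G) : (insAll l).map φ = insAll (l.map φ) := by
  unfold insAll
  rw [map_desc (List.map φ) (g := fun i l => desc (insMul i) l.length l), List.length_map]
  intro i l
  rw [map_desc (List.map φ) (g := insMul i) fun j l => map_insMul φ i j l, List.length_map]

theorem map_extend (φ : G ≃* H) (n : ℕ) (g : G) (l : List G) :
    (extend n g l).map φ = extend n (φ g) (l.map φ) := by
  unfold extend
  rw [map_desc (List.map φ) (g := fun _ => insAll) fun _ l => map_insAll φ l, map_ins]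

theorem Large.map {p k : ℕ} {l : List G} (h : Large p k l) (φ : G ≃* H) :
    Large p k (l.map φ) := by
  obtain ⟨hd, ⟨K, hK⟩, h⟩ := h
  refine ⟨hd.map φ.injective, ⟨K.map φ.toMonoidHom, fun x => ?_⟩, ?_⟩
  · simp [Subgroup.mem_map, hK]
  · rw [List.length_map]
    refine h.imp id fun h x => ?_
    exact List.mem_map.2 ⟨φ.symm x, h _, φ.apply_symm_apply x⟩

/-- The multiplication table with respect to the numbering by a list, starting with `1`. -/
def tab (l : List G) (i j : ℕ) : ℕ := l.idxOf (l.getD i 1 * l.getD j 1) + 1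

theorem idxOf_map {α β : Type*} [DecidableEq α] [DecidableEq β] {f : α → β}
    (hf : Function.Injective f) (l : List α) (x : α) : (l.map f).idxOf (f x) = l.idxOf x := by
  induction l with
  | nil => rfl
  | cons a l ih => simp [List.idxOf_cons, ih, beq_eq_decide, hf.eq_iff]

theorem tab_map (φ : G ≃* H) (l : List G) (i j : ℕ) : tab (l.map φ) i j = tab l i j := by
  unfold tab
  rw [getD_map_one, getD_map_one, ← map_mul, idxOf_map φ.injective]

/-- The multiplication table as one number. -/
def code (n : ℕ) (l : List G) : ℕ :=
  desc (fun i => desc (fun j a => (n + 1) * a + tab l i j) n) n 0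

theorem code_map (φ : G ≃* H) (n : ℕ) (l : List G) : code n (l.map φ) = code n l := by
  unfold code
  simp only [tab_map]

theorem mem_of_length_eq_card [Fintype G] {l : List G} (hd : l.Nodup)
    (hl : l.length = Fintype.card G) (x : G) : x ∈ l := by
  rw [← List.mem_toFinset, (Finset.card_eq_iff_eq_univ _).1
    ((List.toFinset_card_of_nodup hd).trans hl)]
  exact Finset.mem_univ x

theorem tab_lt [Fintype G] {l : List G} (hd : l.Nodup) (hl : l.length = Fintype.card G)
    (i j : ℕ) : tab l i j < Fintype.card G + 1 := by
  have := List.idxOf_lt_length_of_mem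
    (mem_of_length_eq_card hd hl (l.getD i 1 * l.getD j 1))
  unfold tab
  omega

/-- Equal codes have equal digits, so both lists have the same table by positions. Sending the entry
at each position of `l` to the entry of `l'` at that position is then multiplicative, and bijective
since both lists are complete. -/
theorem nonempty_mulEquiv_of_code_eq [Fintype G] [Fintype H] {l : List G} {l' : List H}
    (hc : Fintype.card G = Fintype.card H)
    (hd : l.Nodup) (hl : l.length = Fintype.card G) (hd' : l'.Nodup)
    (hl' : l'.length = Fintype.card H)
    (h : code (Fintype.card G) l = code (Fintype.card G) l') : Nonempty (G ≃* H) := by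
  have ht := (desc_desc_horner_inj (fun i _ j _ => tab_lt hd hl i j)
    (fun i _ j _ => by rw [hc]; exact tab_lt hd' hl' i j) h).2
  have hm := mem_of_length_eq_card hd hl
  have hm' := mem_of_length_eq_card hd' hl'
  have hidx : ∀ x, l.idxOf x < l.length := fun x => List.idxOf_lt_length_of_mem (hm x)
  have hidx' : ∀ x, l'.idxOf x < l'.length := fun x => List.idxOf_lt_length_of_mem (hm' x)
  have hll : l.length = l'.length := by rw [hl, hl', hc]
  let φ : G ≃ H :=
    { toFun := fun x => l'.getD (l.idxOf x) 1
      invFun := fun y => l.getD (l'.idxOf y) 1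
      left_inv := fun x => by
        have h1 : l.idxOf x < l'.length := hll ▸ hidx x
        beta_reduce
        rw [List.getD_eq_getElem _ _ h1, hd'.idxOf_getElem, List.getD_eq_getElem _ _ (hidx x),
          List.getElem_idxOf]
      right_inv := fun y => by
        have h1 : l'.idxOf y < l.length := hll ▸ hidx' y
        beta_reduce
        rw [List.getD_eq_getElem _ _ h1, hd.idxOf_getElem, List.getD_eq_getElem _ _ (hidx' y),
          List.getElem_idxOf] }
  refine ⟨{ φ with map_mul' := fun x y => ?_ }⟩
  have h1 := ht _ (hl ▸ hidx x) _ (hl ▸ hidx y)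
  unfold tab at h1
  rw [List.getD_eq_getElem _ _ (hidx x), List.getD_eq_getElem _ _ (hidx y), List.getElem_idxOf,
    List.getElem_idxOf, Nat.add_right_cancel_iff] at h1
  change l'.getD (l.idxOf (x * y)) 1 = _
  rw [h1, List.getD_eq_getElem _ _ (hidx' _), List.getElem_idxOf]

end Closure

/-! ### Greedy and guessed generators; the collision. -/

section Search

set_option linter.unusedSectionVars false

variable {G H : Type*} [Group G] [DecidableEq G] [Group H] [DecidableEq H] {n : ℕ} [NeZero n]

/-- The element with the smallest number outside `l`, and the one with number `0` if there is
none. -/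
def pick (e : G ≃ Fin n) (l : List G) : G :=
  desc (fun v g => if e.symm (Fin.ofNat n v) ∈ l then g else e.symm (Fin.ofNat n v)) n
    (e.symm (Fin.ofNat n 0))

/-- The scan runs downwards and overwrites, so a candidate outside `l`, once found, is only replaced
by another one. The default survives only if the scan meets no such element. -/
theorem pick_spec (e : G ≃ Fin n) (l : List G) : pick e l ∉ l ∨ ∀ x, x ∈ l := by
  have H : ∀ K g, desc (fun v g => if e.symm (Fin.ofNat n v) ∈ l then g
      else e.symm (Fin.ofNat n v)) K g ∉ l ∨ (desc (fun v g => if e.symm (Fin.ofNat n v) ∈ l then g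
      else e.symm (Fin.ofNat n v)) K g = g ∧ ∀ v < K, e.symm (Fin.ofNat n v) ∈ l) := by
    intro K
    induction K with
    | zero => intro g; simp [desc]
    | succ K ih =>
      intro g
      simp only [desc]
      split_ifs with h
      · refine (ih g).imp id fun h' => ⟨h'.1, fun v hv => ?_⟩
        rcases Nat.lt_succ_iff_lt_or_eq.1 hv with h1 | rfl
        exacts [h'.2 v h1, h]
      · left
        rcases ih (e.symm (Fin.ofNat n K)) with h' | h'
        · exact h'
        · rw [h'.1]; exact h
  refine (H n (e.symm (Fin.ofNat n 0))).imp id fun h x => ?_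
  have := h.2 (e x) (e x).2
  rwa [Fin.ofNat_val_eq_self, Equiv.symm_apply_apply] at this

/-- Extend by new elements, `m` times. -/
def greedy (e : G ≃ Fin n) (m : ℕ) (l : List G) : List G :=
  desc (fun _ l => extend n (pick e l) l) m l

/-- Extend by given elements. -/
def extendBy (n : ℕ) (x : ℕ → G) (m : ℕ) (l : List G) : List G :=
  desc (fun k l => extend n (x k) l) m l

/-- The digits of `t` in base `n`, as elements of the group. -/
def digit (e : G ≃ Fin n) (t k : ℕ) : G := e.symm (Fin.ofNat n (t / n ^ k))

/-- Numbers below $n^m$ enumerate all `m`-tuples of elements, so running through `t` runs through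
all guesses. -/
theorem exists_digit_eq (e : G ≃ Fin n) (m : ℕ) (x : ℕ → G) :
    ∃ t < n ^ m, ∀ k < m, digit e t k = x k := by
  refine ⟨finFunctionFinEquiv fun k : Fin m => e (x k), Fin.is_lt _, fun k hk => ?_⟩
  unfold digit
  rw [Equiv.symm_apply_eq]
  ext
  have h := finFunctionFinEquiv_symm_apply_val
    (finFunctionFinEquiv fun k : Fin m => e (x k)) (⟨k, hk⟩ : Fin m)
  rw [Equiv.symm_apply_apply] at h
  rw [Fin.val_ofNat, ← h]

theorem nodup_greedy (e : G ≃ Fin n) (m : ℕ) {l : List G} (hl : l.Nodup) :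
    (greedy e m l).Nodup :=
  desc_induct (p := List.Nodup) (fun _ _ _ h => nodup_extend h _ _) hl

theorem nodup_extendBy (x : ℕ → G) (m : ℕ) {l : List G} (hl : l.Nodup) :
    (extendBy n x m l).Nodup :=
  desc_induct (p := List.Nodup) (fun _ _ _ h => nodup_extend h _ _) hl

theorem card_eq_of_equiv [Fintype G] (e : G ≃ Fin n) : Fintype.card G = n := by
  rw [Fintype.card_congr e, Fintype.card_fin]

theorem Large.greedy (e : G ≃ Fin n) {p : ℕ} (hp : ∀ q, 2 ≤ q → q ∣ n → p ≤ q)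
    {k : ℕ} {l : List G} (h : Large p k l) (m : ℕ) : Large p (k + m) (greedy e m l) := by
  let _ : Fintype G := Fintype.ofEquiv _ e.symm
  have hc := card_eq_of_equiv e
  unfold RAM.greedy
  induction m generalizing k l with
  | zero => exact h
  | succ m ih =>
    have h1 := h.extend (by rwa [hc]) (pick_spec e l)
    rw [hc] at h1
    have h2 := ih h1
    rwa [add_right_comm, add_assoc] at h2

theorem map_extendBy (φ : G ≃* H) (n : ℕ) (x : ℕ → G) (m : ℕ) (l : List G) :
    (extendBy n x m l).map φ = extendBy n (fun k => φ (x k)) m (l.map φ) :=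
  map_desc (List.map φ) (g := fun k => extend n (φ (x k)))
    (fun k l => map_extend φ n (x k) l) m l

theorem extendBy_congr {x y : ℕ → G} {m : ℕ} (h : ∀ k < m, x k = y k) (l : List G) :
    extendBy n x m l = extendBy n y m l :=
  desc_congr (fun k hk => by simp only [h k hk]) l

/-- The list made from a fixed first half and the second half given by `t`. -/
def listA (e : G ≃ Fin n) (m t : ℕ) : List G := extendBy n (digit e t) m (greedy e m [])

/-- The list made from the first half given by `t` and a second half chosen by `pick`. -/
def listB (e : G ≃ Fin n) (m t : ℕ) : List G := greedy e m (extendBy n (digit e t) m [])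

theorem nodup_listA (e : G ≃ Fin n) (m t : ℕ) : (listA e m t).Nodup :=
  nodup_extendBy _ _ (nodup_greedy _ _ List.nodup_nil)

theorem nodup_listB (e : G ≃ Fin n) (m t : ℕ) : (listB e m t).Nodup :=
  nodup_greedy _ _ (nodup_extendBy _ _ List.nodup_nil)

/-- The collision criterion. -/
theorem nonempty_mulEquiv_iff (e : G ≃ Fin n) (f : H ≃ Fin n) {p j : ℕ} (hp2 : 2 ≤ p)
    (hp : ∀ q, 2 ≤ q → q ∣ n → p ≤ q) (hj : n ≤ p ^ (2 * j)) :
    Nonempty (G ≃* H) ↔ ∃ t' < n ^ (j + 1), (listB f (j + 1) t').length = n ∧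
      ∃ t < n ^ (j + 1), (listA e (j + 1) t).length = n ∧
        code n (listA e (j + 1) t) = code n (listB f (j + 1) t') := by
  let _ : Fintype G := Fintype.ofEquiv _ e.symm
  let _ : Fintype H := Fintype.ofEquiv _ f.symm
  have hcG := card_eq_of_equiv e
  have hcH := card_eq_of_equiv f
  constructor
  · rintro ⟨φ⟩
    -- `pick` depends on the numbering and does not commute with `φ`; so the choices `a` made in `G`
    -- are recorded, and `t'` is the guess that names their images in `H`.
    obtain ⟨a, ha⟩ := exists_desc_eq (extend n) (pick e) (j + 1) []
    obtain ⟨t', ht', hta⟩ := exists_digit_eq f (j + 1) fun k => φ (a k)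
    have h1 : (greedy e (j + 1) []).map φ = extendBy n (digit f t') (j + 1) [] := by
      rw [extendBy_congr hta, greedy, ha]
      exact map_extendBy φ n a (j + 1) []
    -- Conversely, the greedy continuation in `H` is recorded as `c`, and `t` guesses its preimages
    -- in `G`.
    obtain ⟨c, hc⟩ := exists_desc_eq (extend n) (pick f) (j + 1)
      ((greedy e (j + 1) []).map φ)
    obtain ⟨t, ht, htc⟩ := exists_digit_eq e (j + 1) fun k => φ.symm (c k)
    have h2 : (listA e (j + 1) t).map φ = listB f (j + 1) t' := by
      rw [listA, map_extendBy, listB, ← h1]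
      refine Eq.trans ?_ hc.symm
      exact extendBy_congr (fun k hk => by rw [htc k hk, φ.apply_symm_apply]) _
    -- Of the `j + 1` extensions the first counts for nothing and each of the others for a factor
    -- `p`.
    have h3 : Large p j (greedy e (j + 1) []) := by
      have := (large_zero_extend (List.nodup_nil (α := G)) p (pick e [])).greedy e hp j
      rw [hcG, zero_add] at this
      exact this
    have h4 : Large p (j + (j + 1)) (listB f (j + 1) t') := by
      rw [listB, ← h1]
      exact (h3.map φ).greedy f hp (j + 1)
    have h5 : (listB f (j + 1) t').length = n := by
      rw [h4.length_eq, hcH]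
      rw [hcH]
      exact hj.trans (Nat.pow_le_pow_right (by omega) (by omega))
    refine ⟨t', ht', h5, t, ht, ?_, ?_⟩
    · rw [← h2, List.length_map] at h5
      exact h5
    · rw [← h2, code_map]
  · rintro ⟨t', -, h1, t, -, h2, h3⟩
    exact nonempty_mulEquiv_of_code_eq (hcG.trans hcH.symm) (nodup_listA e _ t) (h2.trans hcG.symm)
      (nodup_listB f _ t') (h1.trans hcH.symm) (by rw [hcG]; exact h3)

end Search

/-! ### Machine code for building lists. -/

/-- `r_d := r_a` -/
def copy (d a : ℕ) : Prog := block [.const d 0, .add d d a]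

theorem copy_spec {d a : ℕ} (h : a ≠ d) (s : State) : Runs (copy d a) s (s.setReg d (s.reg a)) 3 := by
  have h1 := Runs.block (l := [.const d 0, .add d d a]) rfl s
  have h2 : blockStep [.const d 0, .add d d a] s = s.setReg d (s.reg a) := by
    ext i
    · simp only [blockStep, Prog.step, State.reg_setReg, if_true, if_neg h, zero_add]
      split_ifs <;> rfl
    · simp [blockStep, Prog.step]
  rw [h2] at h1
  exact h1

/-- `r_d := r_a * r_b`, clearing `r_a` -/
def mulProg (d a b : ℕ) : Prog := .seq (.const d 0) (forDown a (.add d d b))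

theorem desc_add (b K c : ℕ) : desc (fun _ x => x + b) K c = c + K * b := by
  induction K generalizing c with
  | zero => simp [desc]
  | succ K ih => rw [desc, ih]; ring

theorem mulProg_spec {d a b : ℕ} (hda : d ≠ a) (hdb : d ≠ b) (hab : a ≠ b) (hd : d ≠ 1)
    (ha : a ≠ 1) {s : State} (hs : s.reg 1 = 1) :
    ∃ s', Runs (mulProg d a b) s s' (3 * s.reg a + 2) ∧ s'.reg d = s.reg a * s.reg b ∧
      s'.mem = s.mem := by
  obtain ⟨s', h1, h2, h3⟩ := forDown_spec (c := a) (P := .add d d b) (s₀ := s.setReg d 0) (a₀ := 0)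
    (fun x s' => s'.reg d = x ∧ s'.mem = s.mem) (fun _ x => x + s.reg b) 1
    (by simpa [Prog.wr] using hda.symm) (by simpa [Prog.wr] using hd.symm) ha
    (by simp [hd.symm, hs]) (by simp) (fun x s' k h => by simpa [hda] using h)
    (fun k x s' _ h _ hfr => ⟨_, Runs.add .., by
      have := hfr b (by simpa [Prog.wr] using hdb.symm) hab.symm
      simp only [State.reg_setReg, hdb.symm, if_false] at this
      simpa [h.1, this] using h.2⟩)
  simp only [State.reg_setReg, hda.symm, if_false] at h1 h2
  rw [desc_add, zero_add] at h2
  refine ⟨s', ((Runs.const s d 0).seq h1).mono ?_, h2, h3⟩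
  have : len 0 = 1 := rfl
  omega

/-- The registers with the parameters of the computation: the order `n`, the number `m` of chosen
generators, and the positions of the current table, of the list, of the inverse list, of the digits
and of the table of codes. -/
structure Env (n m tb lb : ℕ) (s : State) : Prop where
  one : s.reg 1 = 1
  ord : s.reg 2 = n
  half : s.reg 3 = m
  table : s.reg 5 = tb
  list : s.reg 6 = lb
  inv : s.reg 7 = lb + n
  digits : s.reg 8 = lb + 2 * n
  codes : s.reg 9 = lb + 2 * n + m

theorem Env.of_eq {n m tb lb : ℕ} {s s' : State} (h : Env n m tb lb s)
    (h' : ∀ i ∈ [1, 2, 3, 5, 6, 7, 8, 9], s'.reg i = s.reg i) : Env n m tb lb s' := by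
  simp only [List.forall_mem_cons] at h'
  obtain ⟨h1, h2, h3, h4, h5, h6, h7, h8, -⟩ := h'
  exact ⟨h1.trans h.1, h2.trans h.2, h3.trans h.3, h4.trans h.4, h5.trans h.5, h6.trans h.6,
    h7.trans h.7, h8.trans h.8⟩

theorem Env.setReg {n m tb lb i v : ℕ} {s : State} (h : Env n m tb lb s) (hi : 9 < i) :
    Env n m tb lb (s.setReg i v) :=
  h.of_eq fun j hj => by
    have : j ≠ i := by
      rintro rfl
      simp only [List.mem_cons, List.not_mem_nil, or_false] at hj
      omega
    simp [this]

theorem Env.runs {n m tb lb u : ℕ} {P : Prog} {s s' : State} (h : Env n m tb lb s)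
    (hr : Runs P s s' u) (hP : ∀ i ∈ [1, 2, 3, 5, 6, 7, 8, 9], i ∉ P.wr) : Env n m tb lb s' :=
  h.of_eq fun i hi => hr.frame (hP i hi)

theorem Env.of_frame {n m tb lb c : ℕ} {L : List ℕ} {s s' : State} (h : Env n m tb lb s)
    (h' : ∀ i, i ∉ L → i ≠ c → s'.reg i = s.reg i)
    (hL : ∀ i ∈ [1, 2, 3, 5, 6, 7, 8, 9], i ∉ L ∧ i ≠ c) : Env n m tb lb s' :=
  h.of_eq fun i hi => h' i (hL i hi).1 (hL i hi).2

section

variable {G : Type*} [Group G] [DecidableEq G] {n : ℕ}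

/-- The memory `M` holds the multiplication table at `tb`. -/
def IsTable (e : G ≃ Fin n) (tb : ℕ) (M : ℕ → ℕ) : Prop :=
  ∀ g h, M (e g * n + e h + tb) = e (g * h)

set_option linter.unusedSectionVars false

/-- The memory holds the list `l` at `lb` and its inverse behind it, and agrees with `M`
elsewhere. -/
structure Rep (e : G ≃ Fin n) (lb : ℕ) (M : ℕ → ℕ) (l : List G) (s : State) : Prop where
  nodup : l.Nodup
  len : s.reg 11 = l.length
  list : ∀ i < l.length, s.mem (lb + i) = e (l.getD i 1)
  inv : ∀ g, s.mem (lb + n + e g) = if g ∈ l then l.idxOf g + 1 else 0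
  le : ∀ i < n, s.mem (lb + i) ≤ n
  out : ∀ a, a < lb ∨ lb + 2 * n ≤ a → s.mem a = M a

variable {e : G ≃ Fin n} {lb m tb : ℕ} {M : ℕ → ℕ} {l : List G} {s s' : State}

theorem Rep.of_eq (h : Rep e lb M l s) (h1 : s'.reg 11 = s.reg 11) (h2 : s'.mem = s.mem) :
    Rep e lb M l s' := by
  obtain ⟨a, b, c, d, f, g⟩ := h
  constructor
  · exact a
  · rw [h1, b]
  all_goals rw [h2]; assumption

theorem Rep.setReg (h : Rep e lb M l s) {i v : ℕ} (hi : i ≠ 11) : Rep e lb M l (s.setReg i v) :=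
  h.of_eq (by simp [hi.symm]) rfl

theorem Rep.length_le (h : Rep e lb M l s) : l.length ≤ n := by
  have := (h.nodup.map e.injective).length_le_card
  simpa using this

/-- Append the element in register `13`. -/
def insProg : Prog :=
  .seq (block [.add 20 7 13, .load 21 20])
    (.ite 21 .skip (block [.add 22 6 11, .store 22 13, .add 11 11 1, .store 20 11]))

/-- The inverse list decides membership by one load. It stores position plus one, with `0` for
absence; the length register is incremented before it is stored there, which gives exactly this
value. -/
theorem insProg_spec {g : G} (hE : Env n m tb lb s) (hR : Rep e lb M l s)
    (hg : s.reg 13 = e g) : ∃ s', Runs insProg s s' 20 ∧ Rep e lb M (ins l g) s' := by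
  have h1 := Runs.block (l := [.add 20 7 13, .load 21 20]) rfl s
  simp only [blockStep, Prog.step, State.reg_setReg, State.mem_setReg, if_true, hE.inv, hg, hR.inv]
    at h1
  set s1 := (s.setReg 20 (lb + n + e g)).setReg 21 (if g ∈ l then l.idxOf g + 1 else 0) with hs1
  have hR1 : Rep e lb M l s1 := (hR.setReg (by decide)).setReg (by decide)
  have hlt := (e g).2
  by_cases hgl : g ∈ l
  · refine ⟨s1, (h1.seq (Runs.ite_pos ?_ (.skip _))).mono (by decide), ?_⟩
    · simp [hs1, hgl]
    · rwa [ins, if_pos hgl]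
  · have h2 := Runs.block (l := [.add 22 6 11, .store 22 13, .add 11 11 1, .store 20 11]) rfl s1
    have h3 : s1.reg 21 = 0 := by simp [hs1, hgl]
    refine ⟨_, (h1.seq (Runs.ite_zero h3 h2)).mono (by decide), ?_⟩
    have hnd : (l ++ [g]).Nodup := by
      rw [← List.concat_eq_append]; exact hR.nodup.concat hgl
    have hlen : l.length < n := by
      have := (hnd.map e.injective).length_le_card
      simpa using this
    rw [ins, if_neg hgl]
    simp only [blockStep, Prog.step, State.reg_setReg, State.reg_setMem, hs1]
    simp [hE.list, hE.one, hg, hR.len]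
    constructor
    · exact hnd
    · simp
    · intro i hi
      simp only [List.length_append, List.length_singleton] at hi
      simp only [State.mem_setMem, State.mem_setReg]
      rw [if_neg (by omega)]
      split_ifs with hi'
      · rw [show i = l.length by omega]
        simp
      · rw [List.getD_append _ _ _ _ (by omega)]
        exact hR.list i (by omega)
    · intro x
      simp only [State.mem_setMem, State.mem_setReg]
      have hx := (e x).2
      by_cases hxg : x = g
      · subst hxg
        simp [List.idxOf_append_of_notMem hgl]
      · have : (e x : ℕ) ≠ e g := fun h => hxg (e.injective (Fin.ext h))
        rw [if_neg (by omega), if_neg (by omega), hR.inv]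
        by_cases hxl : x ∈ l
        · simp [hxl, List.idxOf_append_of_mem]
        · simp [hxl, hxg]
    · intro i hi
      simp only [State.mem_setMem, State.mem_setReg]
      rw [if_neg (by omega)]
      split_ifs with hi'
      · omega
      · exact hR.le i hi
    · intro a ha
      simp only [State.mem_setMem, State.mem_setReg]
      rw [if_neg (by omega), if_neg (by omega), hR.out a ha]

/-- Multiply the elements in registers `17` and `18`. -/
def gmulProg : Prog :=
  .seq (mulProg 20 17 2) (block [.add 20 20 18, .add 20 20 5, .load 13 20])

theorem gmulProg_spec {g h : G} (hE : Env n m tb lb s) (hT : IsTable e tb s.mem)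
    (hg : s.reg 17 = e g) (hh : s.reg 18 = e h) :
    ∃ s', Runs gmulProg s s' (3 * n + 10) ∧ s'.reg 13 = e (g * h) ∧ s'.mem = s.mem := by
  obtain ⟨s1, h1, h2, h3⟩ := mulProg_spec (d := 20) (a := 17) (b := 2) (by decide) (by decide)
    (by decide) (by decide) (by decide) hE.one
  have hE1 := hE.runs h1 (by decide)
  have h18 : s1.reg 18 = e h := (h1.frame (by decide)).trans hh
  refine ⟨_, (h1.seq (Runs.block rfl s1)).mono ?_, ?_, ?_⟩
  · have := (e g).2
    have : blockCost [.add 20 20 18, .add 20 20 5, .load 13 20] = 4 := rfl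
    omega
  · simp [blockStep, Prog.step, h2, h18, hE1.table, h3, hg, hE.ord, hT g h]
  · simp [blockStep, Prog.step, h3]

theorem Rep.isTable (hR : Rep e lb M l s) (hT : IsTable e tb M) (hlb : tb + n * n ≤ lb) :
    IsTable e tb s.mem := by
  intro g h
  rw [hR.out, hT g h]
  left
  have h1 := (e g).2
  have h2 := (e h).2
  nlinarith

/-- Load the entries at the positions in registers `15` and `16`, and multiply them. -/
def entryMulProg : Prog :=
  .seq (block [.add 17 6 15, .load 17 17, .add 18 6 16, .load 18 18]) gmulProg

theorem entryMulProg_spec {i j : ℕ} (hE : Env n m tb lb s) (hR : Rep e lb M l s)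
    (hT : IsTable e tb M) (hlb : tb + n * n ≤ lb) (hi : s.reg 15 = i) (hj : s.reg 16 = j)
    (hil : i < l.length) (hjl : j < l.length) :
    ∃ s', Runs entryMulProg s s' (3 * n + 20) ∧
      s'.reg 13 = e (l.getD i 1 * l.getD j 1) ∧ Rep e lb M l s' := by
  have h1 := Runs.block (l := [.add 17 6 15, .load 17 17, .add 18 6 16, .load 18 18]) rfl s
  simp [blockStep, Prog.step, hE.list, hi, hj, hR.list i hil, hR.list j hjl] at h1
  obtain ⟨s2, h2, h3, h4⟩ := gmulProg_spec (e := e) (g := l.getD i 1) (h := l.getD j 1)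
    (hE.runs h1 (by decide)) (by simpa using hR.isTable hT hlb) (by simp) (by simp)
  refine ⟨s2, (h1.seq h2).mono ?_, h3, hR.of_eq ?_ ?_⟩
  · have : blockCost [.add 17 6 15, .load 17 17, .add 18 6 16, .load 18 18] = 5 := rfl
    omega
  · exact (h1.seq h2).frame (by decide)
  · simpa using h4

/-- Append the product of two entries. -/
def insMulProg : Prog := .seq entryMulProg insProg

theorem insMulProg_spec {i j : ℕ} (hE : Env n m tb lb s) (hR : Rep e lb M l s)
    (hT : IsTable e tb M) (hlb : tb + n * n ≤ lb) (hi : s.reg 15 = i) (hj : s.reg 16 = j)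
    (hil : i < l.length) (hjl : j < l.length) :
    ∃ s', Runs insMulProg s s' (3 * n + 40) ∧ Rep e lb M (insMul i j l) s' := by
  obtain ⟨s1, h1, h2, h3⟩ := entryMulProg_spec hE hR hT hlb hi hj hil hjl
  obtain ⟨s2, h4, h5⟩ := insProg_spec (hE.runs h1 (by decide)) h3 h2
  exact ⟨s2, (h1.seq h4).mono (by omega), h5⟩

/-- Append all products of the entry at the position in register `15` with the entries. -/
def insRowProg : Prog := .seq (copy 16 11) (forDown 16 insMulProg)

theorem insRowProg_spec {i : ℕ} (hE : Env n m tb lb s) (hR : Rep e lb M l s)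
    (hT : IsTable e tb M) (hlb : tb + n * n ≤ lb) (hi : s.reg 15 = i) (hil : i < l.length) :
    ∃ s', Runs insRowProg s s' (50 * (n + 1) ^ 2) ∧
      Rep e lb M (desc (insMul i) l.length l) s' := by
  have h1 := copy_spec (d := 16) (a := 11) (by decide) s
  rw [hR.len] at h1
  obtain ⟨s2, h2, h3, -⟩ := forDown_spec (c := 16) (P := insMulProg) (a₀ := l)
    -- The loop bound is frozen at the initial length; since the list only grows, all positions
    -- visited remain valid.
    (fun l' s' => Rep e lb M l' s' ∧ l.length ≤ l'.length) (insMul i) (3 * n + 40)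
    (s₀ := s.setReg 16 l.length) (by decide) (by decide) (by decide) (by simp [hE.one])
    ⟨hR.setReg (by decide), le_rfl⟩ (fun l' s' k h => ⟨h.1.setReg (by decide), h.2⟩) (by
      intro k l' s' hk hR' hs' hfr
      simp only [State.reg_setReg, if_true] at hk
      have hE' : Env n m tb lb s' := (hE.setReg (by decide)).of_frame hfr (by decide)
      have h15 : s'.reg 15 = i := by
        rw [hfr 15 (by decide) (by decide)]; simp [hi]
      obtain ⟨s2, h2, h3⟩ := insMulProg_spec hE' hR'.1 hT hlb h15 hs' (hil.trans_le hR'.2)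
        (hk.trans_le hR'.2)
      exact ⟨s2, h2, h3, hR'.2.trans (prefix_ins _ _).length_le⟩)
  simp only [State.reg_setReg, if_true] at h2 h3
  refine ⟨s2, (h1.seq h2).mono ?_, h3⟩
  have := hR.length_le
  nlinarith

/-- Append all products of two entries. -/
def insAllProg : Prog := .seq (copy 15 11) (forDown 15 insRowProg)

theorem insAllProg_spec (hE : Env n m tb lb s) (hR : Rep e lb M l s)
    (hT : IsTable e tb M) (hlb : tb + n * n ≤ lb) :
    ∃ s', Runs insAllProg s s' (60 * (n + 1) ^ 3) ∧ Rep e lb M (insAll l) s' := by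
  have h1 := copy_spec (d := 15) (a := 11) (by decide) s
  rw [hR.len] at h1
  obtain ⟨s2, h2, h3, -⟩ := forDown_spec (c := 15) (P := insRowProg) (a₀ := l)
    (fun l' s' => Rep e lb M l' s' ∧ l.length ≤ l'.length)
    (fun i l => desc (insMul i) l.length l) (50 * (n + 1) ^ 2)
    (s₀ := s.setReg 15 l.length) (by decide) (by decide) (by decide) (by simp [hE.one])
    ⟨hR.setReg (by decide), le_rfl⟩ (fun l' s' k h => ⟨h.1.setReg (by decide), h.2⟩) (by
      intro k l' s' hk hR' hs' hfr
      simp only [State.reg_setReg, if_true] at hk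
      have hE' : Env n m tb lb s' := (hE.setReg (by decide)).of_frame hfr (by decide)
      obtain ⟨s2, h2, h3⟩ := insRowProg_spec hE' hR'.1 hT hlb hs' (hk.trans_le hR'.2)
      exact ⟨s2, h2, h3,
        hR'.2.trans (prefix_desc_insMul (List.prefix_refl l') _ _).length_le⟩)
  simp only [State.reg_setReg, if_true] at h2 h3
  refine ⟨s2, (h1.seq h2).mono ?_, h3⟩
  have h4 := Nat.mul_le_mul_right (50 * (n + 1) ^ 2 + 2) hR.length_le
  refine (Nat.add_le_add_left (Nat.add_le_add_right h4 1) 3).trans ?_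
  ring_nf; omega

/-- Append the element in register `13`, and then products. -/
def extendProg : Prog := .seq insProg (.seq (copy 14 2) (forDown 14 insAllProg))

theorem extendProg_spec {g : G} (hE : Env n m tb lb s) (hR : Rep e lb M l s)
    (hT : IsTable e tb M) (hlb : tb + n * n ≤ lb) (hg : s.reg 13 = e g) :
    ∃ s', Runs extendProg s s' (100 * (n + 1) ^ 4) ∧ Rep e lb M (extend n g l) s' := by
  obtain ⟨s0, h0, hR0⟩ := insProg_spec hE hR hg
  have hE0 := hE.runs h0 (by decide)
  have h1 := copy_spec (d := 14) (a := 2) (by decide) s0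
  rw [hE0.ord] at h1
  obtain ⟨s2, h2, h3⟩ := forDown_spec (c := 14) (P := insAllProg) (a₀ := ins l g)
    (Rep e lb M) (fun _ => insAll) (60 * (n + 1) ^ 3)
    (s₀ := s0.setReg 14 n) (by decide) (by decide) (by decide) (by simp [hE0.one])
    (hR0.setReg (by decide)) (fun l' s' k h => h.setReg (by decide)) (by
      intro k l' s' hk hR' hs' hfr
      exact insAllProg_spec ((hE0.setReg (by decide)).of_frame hfr (by decide)) hR' hT hlb)
  simp only [State.reg_setReg, if_true] at h2 h3
  refine ⟨s2, (h0.seq (h1.seq h2)).mono ?_, h3⟩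
  ring_nf; omega

/-- Put the first element outside the list into register `13`. -/
def pickProg : Prog :=
  .seq (block [.const 13 0, .const 23 0, .add 23 23 2])
    (forDown 23 (.seq (block [.add 24 7 23, .load 24 24]) (.ite 24 .skip (copy 13 23))))

theorem pickProg_spec [NeZero n] (hE : Env n m tb lb s) (hR : Rep e lb M l s) :
    ∃ s', Runs pickProg s s' (20 * (n + 1)) ∧ s'.reg 13 = e (pick e l) ∧ Rep e lb M l s' := by
  have h1 := Runs.block (l := [.const 13 0, .const 23 0, .add 23 23 2]) rfl s
  simp [blockStep, Prog.step, hE.ord] at h1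
  obtain ⟨s2, h2, h3, h4⟩ := forDown_spec (c := 23)
    (P := .seq (block [.add 24 7 23, .load 24 24]) (.ite 24 .skip (copy 13 23)))
    (a₀ := e.symm (Fin.ofNat n 0)) (fun g s' => s'.reg 13 = e g ∧ Rep e lb M l s')
    (fun v g => if e.symm (Fin.ofNat n v) ∈ l then g else e.symm (Fin.ofNat n v)) 10
    (s₀ := ((s.setReg 13 0).setReg 23 0).setReg 23 n) (by decide) (by decide) (by decide)
    (by simp [hE.one])
    ⟨by simp, ((hR.setReg (by decide)).setReg (by decide)).setReg (by decide)⟩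
    (fun g s' k h => ⟨by simpa using h.1, h.2.setReg (by decide)⟩) (by
      intro k g s' hk hR' hs' hfr
      simp only [State.reg_setReg, if_true] at hk
      have hE' : Env n m tb lb s' :=
        (((hE.setReg (by decide)).setReg (by decide)).setReg (by decide)).of_frame hfr (by decide)
      have h1 := Runs.block (l := [.add 24 7 23, .load 24 24]) rfl s'
      have h2 := hR'.2.inv (e.symm (Fin.ofNat n k))
      rw [Equiv.apply_symm_apply, Fin.val_ofNat, Nat.mod_eq_of_lt hk] at h2
      simp only [blockStep, Prog.step, State.reg_setReg, State.mem_setReg, if_true, hE'.inv, hs',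
        h2] at h1
      split_ifs at h1 ⊢ with hkl
      · exact ⟨_, (h1.seq (Runs.ite_pos (by simp) (.skip _))).mono (by decide),
          by simpa using hR'.1, (hR'.2.setReg (by decide)).setReg (by decide)⟩
      · exact ⟨_, (h1.seq (Runs.ite_zero (by simp) (copy_spec (by decide) _))).mono (by decide),
          by simp [hs', Nat.mod_eq_of_lt hk],
          ((hR'.2.setReg (by decide)).setReg (by decide)).setReg (by decide)⟩)
  simp only [State.reg_setReg, if_true] at h2 h3
  refine ⟨s2, (h1.seq h2).mono ?_, h3, h4⟩
  have : blockCost [.const 13 0, .const 23 0, .add 23 23 2] = 4 := rfl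
  omega

/-- Extend the list by new elements. -/
def greedyProg : Prog := .seq (copy 27 3) (forDown 27 (.seq pickProg extendProg))

theorem greedyProg_spec [NeZero n] (hE : Env n m tb lb s) (hR : Rep e lb M l s)
    (hT : IsTable e tb M) (hlb : tb + n * n ≤ lb) :
    ∃ s', Runs greedyProg s s' (150 * (m + 1) * (n + 1) ^ 4) ∧
      Rep e lb M (greedy e m l) s' := by
  have h1 := copy_spec (d := 27) (a := 3) (by decide) s
  rw [hE.half] at h1
  obtain ⟨s2, h2, h3⟩ := forDown_spec (c := 27) (P := .seq pickProg extendProg) (a₀ := l)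
    (Rep e lb M) (fun _ l => extend n (pick e l) l) (20 * (n + 1) + 100 * (n + 1) ^ 4)
    (s₀ := s.setReg 27 m) (by decide) (by decide) (by decide) (by simp [hE.one])
    (hR.setReg (by decide)) (fun l' s' k h => h.setReg (by decide)) (by
      intro k l' s' hk hR' hs' hfr
      have hE' : Env n m tb lb s' := (hE.setReg (by decide)).of_frame hfr (by decide)
      obtain ⟨s1, h1, h2, hR1⟩ := pickProg_spec hE' hR'
      obtain ⟨s2, h3, h4⟩ := extendProg_spec (hE'.runs h1 (by decide)) hR1 hT hlb h2
      exact ⟨s2, h1.seq h3, h4⟩)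
  simp only [State.reg_setReg, if_true] at h2 h3
  refine ⟨s2, (h1.seq h2).mono ?_, h3⟩
  have h5 : 20 * (n + 1) + 100 * (n + 1) ^ 4 + 2 ≤ 122 * (n + 1) ^ 4 := by
    ring_nf; omega
  have h6 := Nat.mul_le_mul_left m h5
  have h7 : 0 < (n + 1) ^ 4 := by positivity
  nlinarith

/-- The memory `M` holds the digits of `t` in base `n` at `a`. -/
def HasDigits (n m a t : ℕ) (M : ℕ → ℕ) : Prop := ∀ r < m, M (a + r) = t / n ^ r % n

/-- Extend the list by the elements given by the digits. -/
def extendByProg : Prog :=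
  .seq (copy 27 3) (forDown 27 (.seq (block [.add 13 8 27, .load 13 13]) extendProg))

theorem extendByProg_spec [NeZero n] {t : ℕ} (hE : Env n m tb lb s) (hR : Rep e lb M l s)
    (hT : IsTable e tb M) (hlb : tb + n * n ≤ lb) (hD : HasDigits n m (lb + 2 * n) t M) :
    ∃ s', Runs extendByProg s s' (150 * (m + 1) * (n + 1) ^ 4) ∧
      Rep e lb M (extendBy n (digit e t) m l) s' := by
  have h1 := copy_spec (d := 27) (a := 3) (by decide) s
  rw [hE.half] at h1
  obtain ⟨s2, h2, h3⟩ := forDown_spec (c := 27)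
    (P := .seq (block [.add 13 8 27, .load 13 13]) extendProg) (a₀ := l)
    (Rep e lb M) (fun k l => extend n (digit e t k) l) (3 + 100 * (n + 1) ^ 4)
    (s₀ := s.setReg 27 m) (by decide) (by decide) (by decide) (by simp [hE.one])
    (hR.setReg (by decide)) (fun l' s' k h => h.setReg (by decide)) (by
      intro k l' s' hk hR' hs' hfr
      simp only [State.reg_setReg, if_true] at hk
      have hE' : Env n m tb lb s' := (hE.setReg (by decide)).of_frame hfr (by decide)
      have h1 := Runs.block (l := [.add 13 8 27, .load 13 13]) rfl s'
      simp [blockStep, Prog.step, hE'.digits, hs'] at h1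
      rw [hR'.out _ (by omega), hD k hk] at h1
      obtain ⟨s2, h3, h4⟩ := extendProg_spec (g := digit e t k) (hE'.runs h1 (by decide))
        ((hR'.setReg (by decide)).setReg (by decide)) hT hlb (by simp [digit])
      exact ⟨s2, h1.seq h3, h4⟩)
  simp only [State.reg_setReg, if_true] at h2 h3
  refine ⟨s2, (h1.seq h2).mono ?_, h3⟩
  have h5 : 3 + 100 * (n + 1) ^ 4 + 2 ≤ 105 * (n + 1) ^ 4 := by
    ring_nf; omega
  have h6 := Nat.mul_le_mul_left m h5
  have h7 : 0 < (n + 1) ^ 4 := by positivity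
  nlinarith

end

/-! ### Counting through the guesses in base `n`. -/

/-- Increment the digits. -/
def incProg : Prog :=
  .seq (block [.const 20 1, .const 21 0, .const 22 0, .add 22 22 3])
    (forDown 22
      (.seq (block [.add 23 8 21, .load 24 23, .add 24 24 20, .sub 25 2 24, .add 21 21 1])
        (.ite 25 (block [.store 23 24, .const 20 0])
          (block [.const 26 0, .store 23 26, .const 20 1]))))

/-- The carry into position `r` is $1$ exactly if all lower digits of `t` are $n-1$, that is, if
$n^r \mid t+1$. The second part says that the carry out of a position has the same form. -/
theorem succ_div_mod {n t r : ℕ} (hn : 0 < n) :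
    ((t + 1) / n ^ r % n = if t / n ^ r % n + (if n ^ r ∣ t + 1 then 1 else 0) = n then 0
      else t / n ^ r % n + (if n ^ r ∣ t + 1 then 1 else 0)) ∧
    (n ^ (r + 1) ∣ t + 1 ↔ t / n ^ r % n + (if n ^ r ∣ t + 1 then 1 else 0) = n) := by
  have h1 := Nat.succ_div (a := t) (b := n ^ r)
  have h2 := Nat.mod_lt (t / n ^ r) hn
  set q := t / n ^ r with hq
  have hmod : (q + 1) % n = if q % n + 1 = n then 0 else q % n + 1 := by
    rw [Nat.add_mod]
    split_ifs with h
    · rcases Nat.lt_or_ge 1 n with h' | h'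
      · rw [Nat.mod_eq_of_lt h', h, Nat.mod_self]
      · rw [show n = 1 by omega, Nat.mod_one]
    · rw [Nat.mod_eq_of_lt (show 1 < n by omega), Nat.mod_eq_of_lt (by omega)]
  by_cases hd : n ^ r ∣ t + 1
  · simp only [hd, if_true] at h1 ⊢
    refine ⟨by rw [h1, hmod], ?_⟩
    obtain ⟨c, hc⟩ := hd
    have hpos : 0 < n ^ r := by positivity
    rw [hc, Nat.mul_div_cancel_left _ hpos] at h1
    rw [hc, pow_succ, Nat.mul_dvd_mul_iff_left hpos, h1, Nat.dvd_iff_mod_eq_zero, hmod]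
    split_ifs with h <;> simp [h]
  · simp only [hd, if_false, add_zero] at h1 ⊢
    rw [if_neg (by omega), h1]
    refine ⟨rfl, iff_of_false (fun h => hd ((pow_dvd_pow _ (by omega)).trans h)) (by omega)⟩

theorem incProg_spec {n m tb lb t : ℕ} {s : State} (hn : 0 < n) (hE : Env n m tb lb s)
    (hD : HasDigits n m (lb + 2 * n) t s.mem) :
    ∃ s', Runs incProg s s' (20 * (m + 1)) ∧ HasDigits n m (lb + 2 * n) (t + 1) s'.mem ∧
      ∀ a, a < lb + 2 * n ∨ lb + 2 * n + m ≤ a → s'.mem a = s.mem a := by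
  have h1 := Runs.block (l := [.const 20 1, .const 21 0, .const 22 0, .add 22 22 3]) rfl s
  simp [blockStep, Prog.step, hE.half] at h1
  obtain ⟨s2, h2, h3⟩ := forDown_inv (c := 22)
    (P := .seq (block [.add 23 8 21, .load 24 23, .add 24 24 20, .sub 25 2 24, .add 21 21 1])
        (.ite 25 (block [.store 23 24, .const 20 0])
          (block [.const 26 0, .store 23 26, .const 20 1])))
    (s₀ := (((s.setReg 20 1).setReg 21 0).setReg 22 0).setReg 22 m)
    -- The counter descends while carries move upwards, so the current position `m - k` is kept in
    -- register `21` and the carry in register `20`.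
    (fun k s' => k ≤ m ∧ s'.reg 21 = m - k ∧
      s'.reg 20 = (if n ^ (m - k) ∣ t + 1 then 1 else 0) ∧
      (∀ r < m - k, s'.mem (lb + 2 * n + r) = (t + 1) / n ^ r % n) ∧
      (∀ r < m, m - k ≤ r → s'.mem (lb + 2 * n + r) = t / n ^ r % n) ∧
      ∀ a, a < lb + 2 * n ∨ lb + 2 * n + m ≤ a → s'.mem a = s.mem a) 15
    (by decide) (by decide) (by decide) (by simp [hE.one])
    (by simpa using fun r hr => hD r hr) (fun k s' v h => by simpa using h) (by
      rintro k s' hk ⟨hkm, h21, h20, hlo, hhi, hout⟩ - hfr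
      have hE' : Env n m tb lb s' :=
        ((((hE.setReg (by decide)).setReg (by decide)).setReg (by decide)).setReg
          (by decide)).of_frame hfr (by decide)
      obtain ⟨r, hr⟩ : ∃ r, m - (k + 1) = r := ⟨_, rfl⟩
      have hr' : m - k = r + 1 := by omega
      rw [hr] at h21 h20 hlo hhi
      obtain ⟨hdig, hcar⟩ := succ_div_mod (t := t) (r := r) hn
      have h1 := Runs.block
        (l := [.add 23 8 21, .load 24 23, .add 24 24 20, .sub 25 2 24, .add 21 21 1]) rfl s'
      simp only [blockStep, Prog.step, State.reg_setReg, State.mem_setReg] at h1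
      simp [hE'.digits, hE'.ord, hE'.one, h21, h20, hhi r (by omega) le_rfl] at h1
      have hlt := Nat.mod_lt (t / n ^ r) hn
      rw [hr']
      set d := t / n ^ r % n + (if n ^ r ∣ t + 1 then 1 else 0) with hd
      have hdn : d ≤ n := by rw [hd]; split_ifs <;> omega
      by_cases hdn' : d = n
      · refine ⟨_, (h1.seq (Runs.ite_zero ?_ (.block rfl _))).mono (by decide), ?_⟩
        · simp [hdn']
        · rw [if_pos hdn'] at hdig
          refine ⟨by omega, by simp [blockStep, Prog.step],
            by simp [blockStep, Prog.step, hcar.2 hdn'], ?_, ?_, ?_⟩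
          · intro i hi
            simp only [blockStep, Prog.step, State.reg_setReg, State.mem_setReg, State.mem_setMem]
            rcases Nat.lt_succ_iff_lt_or_eq.1 hi with h | rfl
            · simp [h.ne, hlo i h]
            · simp [hdig]
          · intro i hi hi'
            simp only [blockStep, Prog.step, State.reg_setReg, State.mem_setReg, State.mem_setMem]
            simp [show i ≠ r by omega, hhi i hi (by omega)]
          · intro a ha
            simp only [blockStep, Prog.step, State.reg_setReg, State.mem_setReg, State.mem_setMem]
            simp [show a ≠ lb + 2 * n + r by omega, hout a ha]
      · refine ⟨_, (h1.seq (Runs.ite_pos ?_ (.block rfl _))).mono (by decide), ?_⟩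
        · simp; omega
        · rw [if_neg hdn'] at hdig
          refine ⟨by omega, by simp [blockStep, Prog.step],
            by simp [blockStep, Prog.step, hcar, hdn'], ?_, ?_, ?_⟩
          · intro i hi
            simp only [blockStep, Prog.step, State.reg_setReg, State.mem_setReg, State.mem_setMem]
            rcases Nat.lt_succ_iff_lt_or_eq.1 hi with h | rfl
            · simp [h.ne, hlo i h]
            · simp [hdig]
          · intro i hi hi'
            simp only [blockStep, Prog.step, State.reg_setReg, State.mem_setReg, State.mem_setMem]
            simp [show i ≠ r by omega, hhi i hi (by omega)]
          · intro a ha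
            simp only [blockStep, Prog.step, State.reg_setReg, State.mem_setReg, State.mem_setMem]
            simp [show a ≠ lb + 2 * n + r by omega, hout a ha])
  simp only [State.reg_setReg, if_true] at h2
  obtain ⟨-, -, -, h4, -, h5⟩ := h3
  refine ⟨s2, (h1.seq h2).mono ?_, h4, h5⟩
  have : blockCost [.const 20 1, .const 21 0, .const 22 0, .add 22 22 3] = 5 := rfl
  omega

/-! ### Clearing a list, and computing its code. -/

section

variable {G : Type*} [Group G] [DecidableEq G] {n : ℕ}
  {e : G ≃ Fin n} {lb m tb : ℕ} {M : ℕ → ℕ} {l : List G} {s s' : State}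

set_option linter.unusedSectionVars false

/-- Make the list empty. -/
def clearProg : Prog :=
  .seq (block [.const 11 0, .const 23 0, .add 23 23 2])
    (forDown 23 (block [.add 24 7 23, .const 22 0, .store 24 22]))

/-- Only the length and the inverse list are reset. Old entries stay in the list area as garbage;
the bound `hle` on them is all that is needed. -/
theorem clearProg_spec (e : G ≃ Fin n) (hE : Env n m tb lb s)
    (hle : ∀ i < n, s.mem (lb + i) ≤ n) :
    ∃ s', Runs clearProg s s' (20 * (n + 1)) ∧ Rep e lb s.mem [] s' := by
  have h1 := Runs.block (l := [.const 11 0, .const 23 0, .add 23 23 2]) rfl s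
  simp [blockStep, Prog.step, hE.ord] at h1
  obtain ⟨s2, h2, h3, h4, h5⟩ := forDown_inv (c := 23)
    (P := block [.add 24 7 23, .const 22 0, .store 24 22])
    (fun k s' => s'.reg 11 = 0 ∧ (∀ v < n, k ≤ v → s'.mem (lb + n + v) = 0) ∧
      ∀ a, a < lb + n ∨ lb + 2 * n ≤ a → s'.mem a = s.mem a) 10
    (s₀ := ((s.setReg 11 0).setReg 23 0).setReg 23 n) (by decide) (by decide) (by decide)
    (by simp [hE.one])
    (by simp; intro v h h'; omega)
    (fun k s' v h => by simpa using h) (by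
      rintro k s' hk ⟨h11, hz, hout⟩ hs' hfr
      simp only [State.reg_setReg, if_true] at hk
      have hE' : Env n m tb lb s' :=
        (((hE.setReg (by decide)).setReg (by decide)).setReg (by decide)).of_frame hfr (by decide)
      have h1 := Runs.block (l := [.add 24 7 23, .const 22 0, .store 24 22]) rfl s'
      simp [blockStep, Prog.step, hE'.inv, hs'] at h1
      refine ⟨_, h1.mono (by decide), by simp [h11], ?_, ?_⟩
      · intro v hv hkv
        rw [State.mem_setMem]
        split_ifs with h
        · rfl
        · exact hz v hv (by omega)
      · intro a ha
        rw [State.mem_setMem, if_neg (by omega)]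
        exact hout a ha)
  simp only [State.reg_setReg, if_true] at h2
  refine ⟨s2, (h1.seq h2).mono ?_, List.nodup_nil, h3, by simp, fun g => ?_, fun i hi => ?_,
    fun a ha => h5 a (by omega)⟩
  · have : blockCost [.const 11 0, .const 23 0, .add 23 23 2] = 4 := rfl
    omega
  · simpa using h4 _ (e g).2 (Nat.zero_le _)
  · rw [h5 _ (by omega)]
    exact hle i hi

/-- Prepend an entry of the table to the code. -/
def codeEntryProg : Prog :=
  .seq entryMulProg (.seq (block [.add 13 7 13, .load 13 13, .const 25 0, .add 25 25 2])
    (.seq (mulProg 26 25 19) (block [.add 26 26 19, .add 19 26 13])))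

theorem codeEntryProg_spec {i j a : ℕ} (hE : Env n m tb lb s) (hR : Rep e lb M l s)
    (hT : IsTable e tb M) (hlb : tb + n * n ≤ lb) (hi : s.reg 15 = i) (hj : s.reg 16 = j)
    (hil : i < l.length) (hjl : j < l.length) (hfull : ∀ x, x ∈ l) (ha : s.reg 19 = a) :
    ∃ s', Runs codeEntryProg s s' (6 * n + 40) ∧ s'.reg 19 = (n + 1) * a + tab l i j ∧
      Rep e lb M l s' := by
  obtain ⟨s1, h1, h2, hR1⟩ := entryMulProg_spec hE hR hT hlb hi hj hil hjl
  have hE1 := hE.runs h1 (by decide)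
  have h3 := Runs.block (l := [.add 13 7 13, .load 13 13, .const 25 0, .add 25 25 2]) rfl s1
  simp [blockStep, Prog.step, hE1.inv, h2, hR1.inv, hfull, hE1.ord] at h3
  set s2 := ((((s1.setReg 13 (lb + n + e (l.getD i 1 * l.getD j 1))).setReg 13
    (l.idxOf (l.getD i 1 * l.getD j 1) + 1)).setReg 25 0).setReg 25 n) with hs2
  obtain ⟨s3, h4, h5, h6⟩ := mulProg_spec (d := 26) (a := 25) (b := 19) (by decide) (by decide)
    (by decide) (by decide) (by decide) (s := s2) (by simp [hs2, hE1.one])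
  have h19 : s1.reg 19 = a := by rw [h1.frame (by decide), ha]
  have hR3 : Rep e lb M l s3 := by
    refine hR1.of_eq ?_ ?_
    · rw [h4.frame (by decide)]; simp [hs2]
    · rw [h6]; simp [hs2]
  refine ⟨_, (h1.seq (h3.seq (h4.seq (.block rfl s3)))).mono ?_, ?_, ?_⟩
  · have : blockCost [.add 13 7 13, .load 13 13, .const 25 0, .add 25 25 2] = 5 := rfl
    have : blockCost [.add 26 26 19, .add 19 26 13] = 3 := rfl
    have : s2.reg 25 = n := by simp [hs2]
    omega
  · have e1 : s3.reg 19 = a := by rw [h4.frame (by decide)]; simp [hs2, h19]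
    have e2 : s3.reg 13 = tab l i j := by rw [h4.frame (by decide)]; simp [hs2, tab]
    -- The factor $n+1$ is realised as $n$ additions of the long number and one more; the digit was
    -- read directly from the inverse list, whose shift by one is why `tab` starts with $1$.
    simp [blockStep, Prog.step, e1, e2, h5, hs2, h19]
    ring
  · simp only [blockStep, Prog.step]
    exact (hR3.setReg (by decide)).setReg (by decide)

/-- Put the code of the list into register `19`. -/
def codeProg : Prog :=
  .seq (block [.const 19 0, .const 15 0, .add 15 15 2])
    (forDown 15 (.seq (copy 16 2) (forDown 16 codeEntryProg)))

theorem codeProg_spec (hE : Env n m tb lb s) (hR : Rep e lb M l s)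
    (hT : IsTable e tb M) (hlb : tb + n * n ≤ lb) (hl : l.length = n) (hfull : ∀ x, x ∈ l) :
    ∃ s', Runs codeProg s s' (100 * (n + 1) ^ 3) ∧ s'.reg 19 = code n l ∧ Rep e lb M l s' := by
  have h1 := Runs.block (l := [.const 19 0, .const 15 0, .add 15 15 2]) rfl s
  simp [blockStep, Prog.step, hE.ord] at h1
  obtain ⟨s2, h2, h3, h4⟩ := forDown_spec (c := 15)
    (P := .seq (copy 16 2) (forDown 16 codeEntryProg)) (a₀ := 0)
    (fun a s' => s'.reg 19 = a ∧ Rep e lb M l s')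
    (fun i => desc (fun j a => (n + 1) * a + tab l i j) n) (3 + (n * (6 * n + 42) + 1))
    (s₀ := ((s.setReg 19 0).setReg 15 0).setReg 15 n) (by decide) (by decide) (by decide)
    (by simp [hE.one])
    ⟨by simp, ((hR.setReg (by decide)).setReg (by decide)).setReg (by decide)⟩
    (fun a s' k h => ⟨by simpa using h.1, h.2.setReg (by decide)⟩) (by
      intro i a s' hi hR' hs' hfr
      simp only [State.reg_setReg, if_true] at hi
      have hE' : Env n m tb lb s' :=
        (((hE.setReg (by decide)).setReg (by decide)).setReg (by decide)).of_frame hfr (by decide)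
      have h1 := copy_spec (d := 16) (a := 2) (by decide) s'
      rw [hE'.ord] at h1
      obtain ⟨s2, h2, h3⟩ := forDown_spec (c := 16) (P := codeEntryProg) (a₀ := a)
        (fun a s' => s'.reg 19 = a ∧ Rep e lb M l s')
        (fun j a => (n + 1) * a + tab l i j) (6 * n + 40)
        (s₀ := s'.setReg 16 n) (by decide) (by decide) (by decide)
        (by simp [hE'.one]) ⟨by simpa using hR'.1, hR'.2.setReg (by decide)⟩
        (fun a s' k h => ⟨by simpa using h.1, h.2.setReg (by decide)⟩) (by
          intro j a s2 hj hR2 hs2 hfr2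
          simp only [State.reg_setReg, if_true] at hj
          exact codeEntryProg_spec ((hE'.setReg (by decide)).of_frame hfr2 (by decide))
            hR2.2 hT hlb (by rw [hfr2 15 (by decide) (by decide)]; simpa using hs') hs2
            (hl ▸ hi) (hl ▸ hj) hfull hR2.1)
      simp only [State.reg_setReg, if_true] at h2 h3
      exact ⟨s2, h1.seq h2, h3⟩)
  simp only [State.reg_setReg, if_true] at h2 h3
  refine ⟨s2, (h1.seq h2).mono ?_, h3, h4⟩
  have : blockCost [.const 19 0, .const 15 0, .add 15 15 2] = 4 := rfl
  rw [this]
  ring_nf; omega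

/-! ### One round of the search -/

/-- The state of the search after `t` rounds, where `M` is the input. -/
structure Core (n m tb lb t : ℕ) (M : ℕ → ℕ) (s : State) : Prop where
  env : Env n m tb lb s
  input : ∀ a < lb, s.mem a = M a
  le : ∀ i < 2 * n, s.mem (lb + i) ≤ n
  digits : HasDigits n m (lb + 2 * n) t s.mem

theorem Core.setReg {t i v : ℕ} (h : Core n m tb lb t M s) (hi : 9 < i) :
    Core n m tb lb t M (s.setReg i v) :=
  ⟨h.env.setReg hi, h.input, h.le, h.digits⟩

theorem Core.isTable {t : ℕ} (h : Core n m tb lb t M s) (hT : IsTable e tb M)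
    (hlb : tb + n * n ≤ lb) : IsTable e tb s.mem := by
  intro a b
  rw [h.input, hT]
  have h1 := (e a).2
  have h2 := (e b).2
  nlinarith

theorem Core.of_rep {t : ℕ} (h : Core n m tb lb t M s) (hE : Env n m tb lb s')
    (hR : Rep e lb s.mem l s') : Core n m tb lb t M s' := by
  refine ⟨hE, fun a ha => ?_, fun i hi => ?_, fun r hr => ?_⟩
  · rw [hR.out a (.inl ha), h.input a ha]
  · rcases Nat.lt_or_ge i n with hin | hin
    · exact hR.le i hin
    · have h1 := hR.inv (e.symm ⟨i - n, by omega⟩)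
      rw [Equiv.apply_symm_apply, show lb + n + (i - n) = lb + i by omega] at h1
      rw [h1]
      split_ifs with hm
      · exact (List.idxOf_lt_length_of_mem hm).trans_le hR.length_le
      · exact Nat.zero_le _
  · rw [hR.out _ (by omega), h.digits r hr]

theorem Rep.full (hR : Rep e lb M l s) (hl : l.length = n) (x : G) : x ∈ l := by
  let _ : Fintype G := Fintype.ofEquiv _ e.symm
  exact mem_of_length_eq_card hR.nodup (by rw [hl, Fintype.card_congr e, Fintype.card_fin]) x

/-- Build a list by `P`, and if it is complete, compute its code and run `Q`. -/
def roundProg (P Q : Prog) : Prog :=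
  .seq clearProg (.seq P (.seq (.sub 20 2 11) (.ite 20 .skip (.seq codeProg Q))))

/-- Program `P` replaces the empty list by `l`. -/
def Builds (e : G ≃ Fin n) (m tb lb t : ℕ) (P : Prog) (l : List G) : Prop :=
  ∀ (s : State) (M : ℕ → ℕ), Env n m tb lb s → IsTable e tb M →
    HasDigits n m (lb + 2 * n) t M → Rep e lb M [] s →
    ∃ s', Runs P s s' (300 * (m + 1) * (n + 1) ^ 4) ∧ Rep e lb M l s'

/-- A representable list has length at most `n`, so the truncated difference in register `20`
vanishes exactly for complete lists. Only these are coded; `hQ` and `hskip` treat the two branches.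
-/
theorem roundProg_spec {P Q : Prog} {t u : ℕ} (hP : Builds e m tb lb t P l)
    (hPwr : ∀ i ∈ [1, 2, 3, 5, 6, 7, 8, 9], i ∉ P.wr)
    (hT : IsTable e tb M) (hlb : tb + n * n ≤ lb) (hC : Core n m tb lb t M s) (Post : State → Prop)
    (hQ : l.length = n → ∀ s1, Core n m tb lb t M s1 → s1.reg 19 = code n l →
      (∀ a, lb + 2 * n + m ≤ a → s1.mem a = s.mem a) →
      (0 ∉ P.wr → s1.reg 0 = s.reg 0) → ∃ s2, Runs Q s1 s2 u ∧ Post s2)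
    (hskip : l.length ≠ n → ∀ s1, Core n m tb lb t M s1 →
      (∀ a, lb + 2 * n + m ≤ a → s1.mem a = s.mem a) → (0 ∉ P.wr → s1.reg 0 = s.reg 0) → Post s1) :
    ∃ s', Runs (roundProg P Q) s s' (u + 500 * (m + 1) * (n + 1) ^ 4) ∧ Post s' := by
  obtain ⟨s1, h1, hR1⟩ := clearProg_spec e hC.env fun i hi => hC.le i (by omega)
  obtain ⟨s2, h2, hR2⟩ := hP s1 s.mem (hC.env.runs h1 (by decide)) (hC.isTable hT hlb)
    hC.digits hR1
  have hE2 := (hC.env.runs h1 (by decide)).runs h2 hPwr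
  have h3 := Runs.sub s2 20 2 11
  rw [hE2.ord, hR2.len] at h3
  have hE3 := hE2.setReg (i := 20) (v := n - l.length) (by decide)
  have hR3 := hR2.setReg (i := 20) (v := n - l.length) (by decide)
  have h0 : 0 ∉ P.wr → (s2.setReg 20 (n - l.length)).reg 0 = s.reg 0 := fun h => by
    rw [State.reg_setReg, if_neg (by decide), h2.frame h, h1.frame (by decide)]
  have hb : 20 * (n + 1) + (300 * (m + 1) * (n + 1) ^ 4 + (1 + (100 * (n + 1) ^ 3 + 2))) ≤
      500 * (m + 1) * (n + 1) ^ 4 := by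
    have h4 : 20 * (n + 1) + 1 + 100 * (n + 1) ^ 3 + 2 ≤ 200 * (n + 1) ^ 4 := by ring_nf; omega
    have h5 : (n + 1) ^ 4 ≤ (m + 1) * (n + 1) ^ 4 := Nat.le_mul_of_pos_left _ (by omega)
    nlinarith
  by_cases hl : l.length = n
  · obtain ⟨s4, h4, h5, hR4⟩ := codeProg_spec hE3 hR3 (hC.isTable hT hlb) hlb hl (hR3.full hl)
    have hE4 := hE3.runs h4 (by decide)
    obtain ⟨s5, h6, h7⟩ := hQ hl s4 (hC.of_rep hE4 hR4) h5 (fun a ha => hR4.out a (by omega))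
      (fun h => (h4.frame (by decide)).trans (h0 h))
    exact ⟨s5, (h1.seq (h2.seq (h3.seq (Runs.ite_zero (by simp [hl]) (h4.seq h6))))).mono
      (by omega), h7⟩
  · have := hR2.length_le
    exact ⟨_, (h1.seq (h2.seq (h3.seq (Runs.ite_pos (by simp; omega) (.skip _))))).mono
      (by omega), hskip hl _ (hC.of_rep hE3 hR3) (fun a ha => hR3.out a (by omega)) h0⟩

/-- Set the given registers to `0`. -/
def zeroProg (L : List ℕ) : Prog := block (L.map fun i => .const i 0)

theorem zeroProg_spec (L : List ℕ) (s : State) :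
    ∃ s', Runs (zeroProg L) s s' (L.length + 1) ∧ (∀ i ∈ L, s'.reg i = 0) ∧
      (∀ i ∉ L, s'.reg i = s.reg i) ∧ s'.mem = s.mem := by
  induction L generalizing s with
  | nil => exact ⟨s, .skip s, by simp, by simp, rfl⟩
  | cons i L ih =>
    obtain ⟨s', h1, h2, h3, h4⟩ := ih (s.setReg i 0)
    refine ⟨s', ((Runs.const s i 0).seq h1).mono ?_, ?_, ?_, h4⟩
    · have : len 0 = 1 := rfl
      simp only [List.length_cons]
      omega
    · intro j hj
      by_cases hjL : j ∈ L
      · exact h2 j hjL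
      · rw [h3 j hjL]
        simp [(List.mem_cons.1 hj).resolve_right hjL]
    · intro j hj
      simp only [List.mem_cons, not_or] at hj
      rw [h3 j hj.2]
      simp [hj.1]

end

/-! ### Restoring the word length between rounds. -/

/-- The registers for intermediate results. -/
def temps : List ℕ := [11, 13, 14, 15, 16, 17, 18, 19, 20, 21, 22, 23, 24, 25, 26, 27]

/-- Go to the next tuple of digits. -/
def nextProg : Prog := .seq incProg (zeroProg temps)

/-- The long numbers of a round, such as the code and its address, live only in temporary registers,
which are cleared. Memory holds the input, list data at most `n`, digits below `n` and marks at most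
$1$, so the bound `w` holds again whatever happened in the round. -/
theorem nextProg_spec {n m tb lb t w : ℕ} {M : ℕ → ℕ} {s : State} (hn : 0 < n)
    (hC : Core n m tb lb t M s) (hM : ∀ a, M a < 2 ^ w) (hnw : n < 2 ^ w)
    (hreg : ∀ i ∉ temps, s.reg i < 2 ^ w) (hcodes : ∀ a, lb + 2 * n + m ≤ a → s.mem a ≤ 1) :
    ∃ s', Runs nextProg s s' (20 * (m + 1) + 20) ∧ Core n m tb lb (t + 1) M s' ∧ s'.Bounded w ∧
      s'.reg 0 = s.reg 0 ∧ ∀ a, lb + 2 * n + m ≤ a → s'.mem a = s.mem a := by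
  obtain ⟨s1, h1, h2, h3⟩ := incProg_spec hn hC.env hC.digits
  obtain ⟨s2, h4, h5, h6, h7⟩ := zeroProg_spec temps s1
  have hlen : temps.length + 1 ≤ 20 := by decide
  have hC2 : Core n m tb lb (t + 1) M s2 := by
    refine ⟨(hC.env.runs h1 (by decide)).runs h4 (by decide), fun a ha => ?_, fun i hi => ?_, ?_⟩
    · rw [h7, h3 a (by omega), hC.input a ha]
    · rw [h7, h3 _ (by omega)]
      exact hC.le i hi
    · rw [h7]; exact h2
  have hfr : ∀ i, i ∉ temps → s2.reg i = s.reg i := fun i hi => by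
    rw [h6 i hi, h1.frame]
    exact fun h => hi ((show ∀ i ∈ incProg.wr, i ∈ temps by decide) i h)
  refine ⟨s2, (h1.seq h4).mono (by omega), hC2, ⟨fun i => ?_, fun a => ?_⟩, hfr 0 (by decide),
    fun a ha => by rw [h7, h3 a (.inr ha)]⟩
  · by_cases hi : i ∈ temps
    · rw [h5 i hi]; positivity
    · rw [hfr i hi]; exact hreg i hi
  · rcases Nat.lt_or_ge a lb with ha | ha
    · rw [hC2.input a ha]; exact hM a
    rcases Nat.lt_or_ge a (lb + 2 * n) with ha' | ha'
    · have := hC2.le (a - lb) (by omega)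
      rw [Nat.add_sub_cancel' ha] at this
      omega
    rcases Nat.lt_or_ge a (lb + 2 * n + m) with ha2 | ha2
    · have := hC2.digits (a - (lb + 2 * n)) (by omega)
      rw [Nat.add_sub_cancel' ha'] at this
      rw [this]
      exact (Nat.mod_lt _ hn).trans hnw
    · rw [h7, h3 a (.inr ha2)]
      have := hcodes a ha2
      omega

/-! ### The two phases: marking codes from `G`, testing codes from `H`. -/

section

variable {G H : Type*} [Group G] [DecidableEq G] [Group H] [DecidableEq H] {n : ℕ} [NeZero n]
  {lb m tb : ℕ} {M : ℕ → ℕ} {s s' : State}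

open Classical in
/-- The characteristic function of the codes found in the first `t` rounds. -/
noncomputable def marks (e : G ≃ Fin n) (m t q : ℕ) : ℕ :=
  if ∃ t' < t, (listA e m t').length = n ∧ code n (listA e m t') = q then 1 else 0

theorem marks_succ (e : G ≃ Fin n) (m t q : ℕ) : marks e m (t + 1) q =
    if (listA e m t).length = n ∧ code n (listA e m t) = q then 1 else marks e m t q := by
  simp only [marks, Nat.lt_succ_iff_lt_or_eq, or_and_right, exists_or, exists_eq_left]
  grind

theorem marks_le (e : G ≃ Fin n) (m t q : ℕ) : marks e m t q ≤ 1 := by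
  unfold marks; split_ifs <;> simp

/-- One round of the first phase. -/
def markProg : Prog :=
  .seq (roundProg (.seq greedyProg extendByProg) (block [.add 19 19 9, .store 19 1])) nextProg

theorem markProg_spec (e : G ≃ Fin n) {t w : ℕ} (hT : IsTable e tb M) (hlb : tb + n * n ≤ lb)
    (hC : Core n m tb lb t M s) (hM : ∀ a, M a < 2 ^ w) (hnw : n < 2 ^ w)
    (hb : s.Bounded w) (h0 : s.reg 0 = 0)
    (hmarks : ∀ q, s.mem (lb + 2 * n + m + q) = marks e m t q) :
    ∃ s', Runs markProg s s' (600 * (m + 1) * (n + 1) ^ 4) ∧ Core n m tb lb (t + 1) M s' ∧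
      s'.Bounded w ∧ s'.reg 0 = 0 ∧
      ∀ q, s'.mem (lb + 2 * n + m + q) = marks e m (t + 1) q := by
  have hbuild : Builds e m tb lb t (.seq greedyProg extendByProg) (listA e m t) := by
    intro s M hE hT hD hR
    obtain ⟨s1, h1, hR1⟩ := greedyProg_spec hE hR hT hlb
    obtain ⟨s2, h2, hR2⟩ := extendByProg_spec (hE.runs h1 (by decide)) hR1 hT hlb hD
    exact ⟨s2, (h1.seq h2).mono (le_of_eq (by ring)), hR2⟩
  obtain ⟨s1, h1, hC1, h01, hm1⟩ := roundProg_spec (u := 10) hbuild (by decide)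
    (Q := block [.add 19 19 9, .store 19 1]) hT hlb hC
    (fun s' => Core n m tb lb t M s' ∧ s'.reg 0 = 0 ∧
      ∀ q, s'.mem (lb + 2 * n + m + q) = marks e m (t + 1) q)
    (by
      intro hl s1 hC1 h19 hmem h01
      have h1 := Runs.block (l := [.add 19 19 9, .store 19 1]) rfl s1
      simp [blockStep, Prog.step, h19, hC1.env.codes, hC1.env.one] at h1
      refine ⟨_, h1.mono (by decide), ⟨hC1.env.of_eq (by simp), fun a ha => ?_,
        fun i hi => ?_, fun r hr => ?_⟩, ?_, fun q => ?_⟩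
      · rw [State.mem_setMem, if_neg (by omega)]; exact hC1.input a ha
      · rw [State.mem_setMem, if_neg (by omega)]; exact hC1.le i hi
      · rw [State.mem_setMem, if_neg (by omega)]; exact hC1.digits r hr
      · simpa [h0] using h01 (by decide)
      · rw [State.mem_setMem, marks_succ, State.mem_setReg, hmem _ (by omega), hmarks]
        refine if_congr ?_ rfl rfl
        simp only [hl, true_and]
        omega)
    (by
      intro hl s1 hC1 hmem h01
      refine ⟨hC1, (h01 (by decide)).trans h0, fun q => ?_⟩
      rw [hmem _ (by omega), hmarks, marks_succ, if_neg (fun h => hl h.1)])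
  obtain ⟨s2, h2, hC2, hb2, h02, hm2⟩ := nextProg_spec (Nat.pos_of_ne_zero (NeZero.ne n)) hC1 hM
    hnw
    (fun i hi => by
      by_cases hi0 : i = 0
      · rw [hi0, h01]; positivity
      rw [h1.frame]
      · exact hb.1 i
      · exact fun h => (List.mem_cons.1 ((show ∀ i ∈ (roundProg (.seq greedyProg extendByProg)
          (block [.add 19 19 9, .store 19 1])).wr, i ∈ 0 :: temps by decide) i h)).elim hi0 hi)
    (fun a ha => by
      have := hm1 (a - (lb + 2 * n + m))
      rw [Nat.add_sub_cancel' ha] at this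
      rw [this]
      exact marks_le ..)
  refine ⟨s2, (h1.seq h2).mono ?_, hC2, hb2, h02.trans h01, fun q => ?_⟩
  · have : (m + 1) * 1 ≤ (m + 1) * (n + 1) ^ 4 := Nat.mul_le_mul_left _ (by
      have : 0 < (n + 1) ^ 4 := by positivity
      omega)
    nlinarith
  · rw [hm2 _ (by omega), hm1]

open Classical in
/-- Has a code marked in `F` been found in the first `t` rounds? -/
noncomputable def hit (f : H ≃ Fin n) (m : ℕ) (F : ℕ → ℕ) (t : ℕ) : ℕ :=
  if ∃ t' < t, (listB f m t').length = n ∧ F (code n (listB f m t')) ≠ 0 then 1 else 0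

theorem hit_succ (f : H ≃ Fin n) (m : ℕ) (F : ℕ → ℕ) (t : ℕ) : hit f m F (t + 1) =
    if (listB f m t).length = n ∧ F (code n (listB f m t)) ≠ 0 then 1 else hit f m F t := by
  simp only [hit, Nat.lt_succ_iff_lt_or_eq, or_and_right, exists_or, exists_eq_left]
  grind

theorem hit_le (f : H ≃ Fin n) (m : ℕ) (F : ℕ → ℕ) (t : ℕ) : hit f m F t ≤ 1 := by
  unfold hit; split_ifs <;> simp

/-- One round of the second phase. -/
def testProg : Prog :=
  .seq (roundProg (.seq extendByProg greedyProg)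
    (.seq (block [.add 19 19 9, .load 20 19]) (.ite 20 (.const 0 1) .skip))) nextProg

theorem testProg_spec (f : H ≃ Fin n) {t w : ℕ} {F : ℕ → ℕ} (hT : IsTable f tb M)
    (hlb : tb + n * n ≤ lb)
    (hC : Core n m tb lb t M s) (hM : ∀ a, M a < 2 ^ w) (hnw : n < 2 ^ w)
    (hb : s.Bounded w) (hF : ∀ q, F q ≤ 1) (h0 : s.reg 0 = hit f m F t)
    (hmarks : ∀ q, s.mem (lb + 2 * n + m + q) = F q) :
    ∃ s', Runs testProg s s' (600 * (m + 1) * (n + 1) ^ 4) ∧ Core n m tb lb (t + 1) M s' ∧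
      s'.Bounded w ∧ s'.reg 0 = hit f m F (t + 1) ∧
      ∀ q, s'.mem (lb + 2 * n + m + q) = F q := by
  have hbuild : Builds f m tb lb t (.seq extendByProg greedyProg) (listB f m t) := by
    intro s M hE hT hD hR
    obtain ⟨s1, h1, hR1⟩ := extendByProg_spec hE hR hT hlb hD
    obtain ⟨s2, h2, hR2⟩ := greedyProg_spec (hE.runs h1 (by decide)) hR1 hT hlb
    exact ⟨s2, (h1.seq h2).mono (le_of_eq (by ring)), hR2⟩
  obtain ⟨s1, h1, hC1, h01, hm1⟩ := roundProg_spec (u := 10) hbuild (by decide)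
    (Q := .seq (block [.add 19 19 9, .load 20 19]) (.ite 20 (.const 0 1) .skip)) hT hlb hC
    (fun s' => Core n m tb lb t M s' ∧ s'.reg 0 = hit f m F (t + 1) ∧
      ∀ q, s'.mem (lb + 2 * n + m + q) = F q)
    (by
      intro hl s1 hC1 h19 hmem h01
      have h1 := Runs.block (l := [.add 19 19 9, .load 20 19]) rfl s1
      simp only [blockStep, Prog.step, State.reg_setReg, State.mem_setReg, if_true, h19,
        hC1.env.codes] at h1
      rw [add_comm (code n _), hmem _ (by omega), hmarks] at h1
      by_cases hf : F (code n (listB f m t)) = 0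
      · refine ⟨_, (h1.seq (Runs.ite_zero (by simp [hf]) (.skip _))).mono (by decide),
          (hC1.setReg (by decide)).setReg (by decide), ?_, fun q => ?_⟩
        · simp [hit_succ, hf, h01 (by decide), h0]
        · rw [State.mem_setReg, State.mem_setReg, hmem _ (by omega), hmarks]
      · refine ⟨_, (h1.seq (Runs.ite_pos (by simpa using hf) (.const _ 0 1))).mono (by decide),
          ⟨hC1.env.of_eq (by simp), hC1.input, hC1.le,
            hC1.digits⟩, ?_, fun q => ?_⟩
        · simp [hit_succ, hf, hl]
        · rw [State.mem_setReg, State.mem_setReg, State.mem_setReg, hmem _ (by omega), hmarks])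
    (by
      intro hl s1 hC1 hmem h01
      refine ⟨hC1, ?_, fun q => ?_⟩
      · rw [h01 (by decide), h0, hit_succ, if_neg (fun h => hl h.1)]
      · rw [hmem _ (by omega), hmarks])
  have hw1 : 1 < 2 ^ w := (Nat.one_le_iff_ne_zero.2 (NeZero.ne n)).trans_lt hnw
  obtain ⟨s2, h2, hC2, hb2, h02, hm2⟩ := nextProg_spec (Nat.pos_of_ne_zero (NeZero.ne n)) hC1 hM
    hnw
    (fun i hi => by
      by_cases hi0 : i = 0
      · rw [hi0, h01]; exact (hit_le ..).trans_lt hw1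
      rw [h1.frame]
      · exact hb.1 i
      · exact fun h => (List.mem_cons.1 ((show ∀ i ∈ (roundProg (.seq extendByProg greedyProg)
          (.seq (block [.add 19 19 9, .load 20 19]) (.ite 20 (.const 0 1) .skip))).wr,
          i ∈ 0 :: temps by decide) i h)).elim hi0 hi)
    (fun a ha => by
      have := hm1 (a - (lb + 2 * n + m))
      rw [Nat.add_sub_cancel' ha] at this
      rw [this]
      exact hF _)
  refine ⟨s2, (h1.seq h2).mono ?_, hC2, hb2, h02.trans h01, fun q => ?_⟩
  · have : (m + 1) * 1 ≤ (m + 1) * (n + 1) ^ 4 := Nat.mul_le_mul_left _ (by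
      have : 0 < (n + 1) ^ 4 := by positivity
      omega)
    nlinarith
  · rw [hm2 _ (by omega), hm1]

/-- Both phases. -/
def searchProg : Prog :=
  .seq (copy 12 4) (.seq (forDown 12 markProg)
    (.seq (copy 5 10) (.seq (copy 12 4) (forDown 12 testProg))))

theorem exec_copy {d a w : ℕ} (h : a ≠ d) (hb : s.Bounded w) :
    ∃ t, Exec (copy d a) s (s.setReg d (s.reg a)) t ∧ (s.setReg d (s.reg a)).Bounded w ∧
      t ≤ 6 * (w + 3) := by
  obtain ⟨t, h1, h2⟩ := copy_spec h s
  exact ⟨t, h1, hb.setReg (hb.1 a), by have := (h2 w hb).2; omega⟩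

/-- Both phases run $n^m$ rounds from one word length `w`, so `forDown_exec` applies to each.
Nothing is reset in between except the table position and the counter. -/
theorem searchProg_spec (e : G ≃ Fin n) (f : H ≃ Fin n) {w tb' : ℕ}
    (hT : IsTable e tb M) (hT' : IsTable f tb' M) (hlb : tb + n * n ≤ lb)
    (hlb' : tb' + n * n ≤ lb) (hC : Core n m tb lb 0 M s) (hM : ∀ a, M a < 2 ^ w)
    (hb : s.Bounded w) (h0 : s.reg 0 = 0) (h4 : s.reg 4 = n ^ m) (h10 : s.reg 10 = tb')
    (hz : ∀ q, s.mem (lb + 2 * n + m + q) = 0) :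
    ∃ s' t, Exec searchProg s s' t ∧
      (s'.reg 0 = 1 ↔ ∃ t' < n ^ m, (listB f m t').length = n ∧
        ∃ t < n ^ m, (listA e m t).length = n ∧ code n (listA e m t) = code n (listB f m t')) ∧
      t ≤ 20 * (w + 3) + 2 * ((n ^ m + 1) * (2 * (600 * (m + 1) * (n + 1) ^ 4 + 2) *
        (w + 600 * (m + 1) * (n + 1) ^ 4 + 2))) := by
  have hnw : n < 2 ^ w := by rw [← hC.env.ord]; exact hb.1 2
  have hNw : n ^ m < 2 ^ w := by rw [← h4]; exact hb.1 4
  obtain ⟨t1, hx1, hb1, ht1⟩ := exec_copy (d := 12) (a := 4) (by decide) hb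
  rw [h4] at hx1 hb1
  obtain ⟨s2, t2, hx2, hI2, ht2⟩ := forDown_exec (c := 12) (P := markProg)
    (s₀ := s.setReg 12 (n ^ m))
    (fun k s => k ≤ n ^ m ∧ Core n m tb lb (n ^ m - k) M s ∧ s.Bounded w ∧ s.reg 0 = 0 ∧
      ∀ q, s.mem (lb + 2 * n + m + q) = marks e m (n ^ m - k) q)
    (600 * (m + 1) * (n + 1) ^ 4) w (by decide) (by decide) (by decide) (by simp [hC.env.one])
    ⟨by simp, by simpa using hC.setReg (by decide), hb1, by simpa using h0,
      by simpa [marks] using hz⟩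
    (fun k s h => ⟨h.1, h.2.1.setReg (by decide), h.2.2.1.setReg (by omega), by
      simpa using h.2.2.2.1, h.2.2.2.2⟩)
    (fun k s h => h.2.2.1)
    (by
      rintro k s' hk ⟨hkN, hC', hb', h0', hm'⟩ - -
      obtain ⟨s2, h2, h3, h4, h5, h6⟩ := markProg_spec e hT hlb hC' hM hnw hb' h0' hm'
      rw [show n ^ m - (k + 1) + 1 = n ^ m - k by omega] at h3 h6
      exact ⟨s2, h2, by omega, h3, h4, h5, h6⟩)
  obtain ⟨-, hC2, hb2, h02, hm2⟩ := hI2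
  have f4 : s2.reg 4 = n ^ m := by rw [hx2.frame 4 (by decide)]; simp [h4]
  have f10 : s2.reg 10 = tb' := by rw [hx2.frame 10 (by decide)]; simp [h10]
  obtain ⟨t3, hx3, hb3, ht3⟩ := exec_copy (d := 5) (a := 10) (by decide) hb2
  obtain ⟨t4, hx4, hb4, ht4⟩ := exec_copy (d := 12) (a := 4) (by decide) hb3
  have hE4 : Env n m tb' lb ((s2.setReg 5 (s2.reg 10)).setReg 12 (n ^ m)) := by
    obtain ⟨a, b, c, d, f, g, h, i⟩ := hC2.env
    constructor <;> simpa
  have e4 : (s2.setReg 5 (s2.reg 10)).reg 4 = n ^ m := by simp [f4]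
  rw [e4] at hx4 hb4
  -- After $n^m$ increments the `m` digits have overflowed to zero, so the second phase starts at
  -- the first guess without initialisation.
  have hD : HasDigits n m (lb + 2 * n) 0 s2.mem := by
    intro r hr
    rw [hC2.digits r hr, Nat.sub_zero, Nat.pow_div hr.le (Nat.pos_of_ne_zero (NeZero.ne n)),
      Nat.zero_div, Nat.zero_mod, Nat.mod_eq_zero_of_dvd]
    exact dvd_pow_self _ (by omega)
  obtain ⟨s5, t5, hx5, hI5, ht5⟩ := forDown_exec (c := 12) (P := testProg)
    (s₀ := (s2.setReg 5 (s2.reg 10)).setReg 12 (n ^ m))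
    (fun k s => k ≤ n ^ m ∧ Core n m tb' lb (n ^ m - k) M s ∧ s.Bounded w ∧
      s.reg 0 = hit f m (marks e m (n ^ m)) (n ^ m - k) ∧
      ∀ q, s.mem (lb + 2 * n + m + q) = marks e m (n ^ m) q)
    (600 * (m + 1) * (n + 1) ^ 4) w (by decide) (by decide) (by decide) (by simp [hC2.env.one])
    ⟨by simp, by simpa using ⟨hE4, hC2.input, hC2.le, hD⟩, hb4, by simpa [hit] using h02,
      by simpa using hm2⟩
    (fun k s h => ⟨h.1, h.2.1.setReg (by decide), h.2.2.1.setReg (by omega), by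
      simpa using h.2.2.2.1, h.2.2.2.2⟩)
    (fun k s h => h.2.2.1)
    (by
      rintro k s' hk ⟨hkN, hC', hb', h0', hm'⟩ - -
      obtain ⟨s2, h2, h3, h4, h5, h6⟩ := testProg_spec f hT' hlb' hC' hM hnw hb'
        (marks_le e m (n ^ m)) h0' hm'
      rw [show n ^ m - (k + 1) + 1 = n ^ m - k by omega] at h3 h5
      exact ⟨s2, h2, by omega, h3, h4, h5, h6⟩)
  refine ⟨s5, _, .seq hx1 (.seq hx2 (.seq hx3 (.seq hx4 hx5))), ?_, ?_⟩
  · rw [hI5.2.2.2.1]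
    simp [hit, marks]
  · simp only [State.reg_setReg, if_true] at ht2 ht5
    omega

end

/-! ### Computing the smallest prime divisor and the number of generators. -/

/-- Replace the number in register `21` by the one in register `23` if that divides the order. -/
def divProg : Prog :=
  .seq (block [.const 24 0, .const 25 0, .add 25 25 2])
    (forDown 25 (.seq (block [.add 24 24 23, .sub 26 24 2, .sub 27 2 24, .add 26 26 27])
      (.ite 26 .skip (copy 21 23))))

/-- Divisibility is tested by comparing `n` with $d, 2d, \dots, nd$; a sum of the two truncated
differences is zero exactly at equality. -/
theorem divProg_spec {n d p : ℕ} {s : State} (h1 : s.reg 1 = 1) (hn : s.reg 2 = n)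
    (h21 : s.reg 21 = p) (h23 : s.reg 23 = d) (hn0 : 0 < n) :
    ∃ s', Runs divProg s s' (30 * (n + 1)) ∧ s'.reg 21 = (if d ∣ n then d else p) ∧
      s'.mem = s.mem := by
  classical
  have hr := Runs.block (l := [.const 24 0, .const 25 0, .add 25 25 2]) rfl s
  simp [blockStep, Prog.step, hn] at hr
  obtain ⟨s2, h2, h3, h4, h5⟩ := forDown_inv (c := 25)
    (P := .seq (block [.add 24 24 23, .sub 26 24 2, .sub 27 2 24, .add 26 26 27])
      (.ite 26 .skip (copy 21 23)))
    (s₀ := ((s.setReg 24 0).setReg 25 0).setReg 25 n)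
    (fun k s' => s'.reg 24 = (n - k) * d ∧
      s'.reg 21 = (if ∃ c, 1 ≤ c ∧ c ≤ n - k ∧ c * d = n then d else p) ∧ s'.mem = s.mem) 20
    (by decide) (by decide) (by decide) (by simp [h1])
    (by
      have : ¬∃ c, 1 ≤ c ∧ c ≤ n - n ∧ c * d = n := by rintro ⟨c, h, h', -⟩; omega
      simp only [State.reg_setReg, if_true, if_neg this]
      simp [h21])
    (fun k s' v h => by simpa using h) (by
      rintro k s' hk ⟨h24, h21, hmem⟩ hs' hfr
      simp only [State.reg_setReg, if_true] at hk
      have e2 : s'.reg 2 = n := by rw [hfr 2 (by decide) (by decide)]; simp [hn]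
      have e23 : s'.reg 23 = d := by rw [hfr 23 (by decide) (by decide)]; simp [h23]
      have hr := Runs.block
        (l := [.add 24 24 23, .sub 26 24 2, .sub 27 2 24, .add 26 26 27]) rfl s'
      have hmul : (n - (k + 1)) * d + d = (n - k) * d := by
        rw [show n - k = n - (k + 1) + 1 by omega]; ring
      have hiff : (∃ c, 1 ≤ c ∧ c ≤ n - k ∧ c * d = n) ↔
          (∃ c, 1 ≤ c ∧ c ≤ n - (k + 1) ∧ c * d = n) ∨ (n - k) * d = n := by
        constructor
        · rintro ⟨c, h, h', h''⟩
          rcases Nat.lt_or_ge (n - (k + 1)) c with hc | hc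
          · right; rwa [show n - k = c by omega]
          · exact .inl ⟨c, h, hc, h''⟩
        · rintro (⟨c, h, h', h''⟩ | h)
          · exact ⟨c, h, by omega, h''⟩
          · exact ⟨n - k, by omega, le_rfl, h⟩
      simp [blockStep, Prog.step, h24, e2, e23, hmul] at hr
      by_cases hd : (n - k) * d = n
      · refine ⟨_, (hr.seq (Runs.ite_zero (by simp [hd]) (copy_spec (by decide) _))).mono
          (by decide), by simp, ?_, by simp [hmem]⟩
        rw [if_pos (hiff.2 (.inr hd))]
        simp [e23]
      · refine ⟨_, (hr.seq (Runs.ite_pos (by simp; omega) (.skip _))).mono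
          (by decide), by simp, ?_, by simp [hmem]⟩
        simp only [State.reg_setReg]
        simp only [hiff, hd, or_false]
        simpa using h21)
  simp only [State.reg_setReg, if_true] at h2
  refine ⟨s2, (hr.seq h2).mono ?_, ?_, h5⟩
  · have : blockCost [.const 24 0, .const 25 0, .add 25 25 2] = 4 := rfl
    omega
  · rw [h4]
    refine if_congr ⟨?_, ?_⟩ rfl rfl
    · rintro ⟨c, -, -, h⟩
      exact ⟨c, by rw [← h, mul_comm]⟩
    · rintro ⟨c, h⟩
      have hc : 1 ≤ c := Nat.one_le_iff_ne_zero.2 (by rintro rfl; omega)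
      have hd : 1 ≤ d := Nat.one_le_iff_ne_zero.2 (by rintro rfl; omega)
      exact ⟨c, hc, by rw [Nat.sub_zero, h]; exact Nat.le_mul_of_pos_left c hd,
        by rw [h, mul_comm]⟩

/-- Put the smallest prime divisor of the order into register `21`. -/
def minFacProg : Prog :=
  .seq (block [.const 21 2, .sub 22 2 1])
    (forDown 22 (.seq (block [.add 23 22 1, .add 23 23 1]) divProg))

/-- Candidates run from `n` down to $2$, so the last divisor kept is the smallest. The initial value
$2$ survives unreplaced only for $n = 1$, where every $p \ge 2$ serves. -/
theorem minFacProg_spec {n : ℕ} {s : State} (h1 : s.reg 1 = 1) (hn : s.reg 2 = n) (hn0 : 0 < n) :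
    ∃ s', Runs minFacProg s s' (50 * (n + 1) ^ 2) ∧ 2 ≤ s'.reg 21 ∧ s'.reg 21 ≤ n + 1 ∧
      (∀ q, 2 ≤ q → q ∣ n → s'.reg 21 ≤ q) ∧ (2 ≤ n → s'.reg 21 ∣ n) ∧ s'.mem = s.mem := by
  have hr := Runs.block (l := [.const 21 2, .sub 22 2 1]) rfl s
  simp [blockStep, Prog.step, hn, h1] at hr
  obtain ⟨s2, h2, h3, h3', h4, h5, h6⟩ := forDown_inv (c := 22)
    (P := .seq (block [.add 23 22 1, .add 23 23 1]) divProg)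
    (s₀ := (s.setReg 21 2).setReg 22 (n - 1))
    (fun k s' => 2 ≤ s'.reg 21 ∧ s'.reg 21 ≤ n + 1 ∧ (∀ q, k + 2 ≤ q → q ∣ n → s'.reg 21 ≤ q) ∧
      (s'.reg 21 ∣ n ∨ ∀ q, k + 2 ≤ q → ¬q ∣ n) ∧ s'.mem = s.mem) (3 + 30 * (n + 1))
    (by decide) (by decide) (by decide) (by simp [h1])
    (by
      have : ∀ q, n - 1 + 2 ≤ q → ¬q ∣ n := fun q hq hqn => by
        have := Nat.le_of_dvd hn0 hqn
        omega
      simp only [State.reg_setReg, if_true]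
      exact ⟨by simp, by simp; omega, fun q hq h => absurd h (this q hq), .inr this, rfl⟩)
    (fun k s' v h => by simpa using h) (by
      rintro k s' hk ⟨ha, ha', hb, hc, hmem⟩ hs' hfr
      simp only [State.reg_setReg, if_true] at hk
      have e1 : s'.reg 1 = 1 := by rw [hfr 1 (by decide) (by decide)]; simp [h1]
      have e2 : s'.reg 2 = n := by rw [hfr 2 (by decide) (by decide)]; simp [hn]
      have hr := Runs.block (l := [.add 23 22 1, .add 23 23 1]) rfl s'
      simp [blockStep, Prog.step, hs', e1] at hr
      obtain ⟨s2, h2, h3, h4⟩ := divProg_spec (n := n) (d := k + 2) (p := s'.reg 21)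
        (s := (s'.setReg 23 (k + 1)).setReg 23 (k + 1 + 1)) (by simp [e1]) (by simp [e2])
        (by simp) (by simp) hn0
      refine ⟨s2, hr.seq h2, ?_⟩
      rw [h3]
      by_cases hd : k + 2 ∣ n
      · simp only [hd, if_true]
        exact ⟨by omega, by omega, fun q hq _ => hq, .inl trivial, h4.trans hmem⟩
      · simp only [hd, if_false]
        refine ⟨ha, ha', fun q hq hqn => ?_, hc.imp id fun hc q hq hqn => ?_, h4.trans hmem⟩
        · rcases hq.eq_or_lt with rfl | hq
          exacts [absurd hqn hd, hb q (by omega) hqn]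
        · rcases hq.eq_or_lt with rfl | hq
          exacts [hd hqn, hc q (by omega) hqn])
  simp only [State.reg_setReg, if_true] at h2
  refine ⟨s2, (hr.seq h2).mono ?_, h3, h3', h4, fun hn2 => h5.resolve_right fun h => ?_, h6⟩
  · have : blockCost [.const 21 2, .sub 22 2 1] = 4 := rfl
    have h7 := Nat.mul_le_mul_right (3 + 30 * (n + 1) + 2) (Nat.sub_le n 1)
    nlinarith
  · exact h n (by omega) dvd_rfl

/-- One more factor for the power in register `28`, while that is less than the order. -/
def powStepProg : Prog :=
  .seq (.sub 30 2 28) (.ite 30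
    (.seq (block [.add 3 3 1, .const 31 0, .add 31 31 2]) (.seq (mulProg 32 31 4)
      (.seq (block [.const 4 0, .add 4 4 32, .const 31 0, .add 31 31 21])
        (.seq (mulProg 32 31 28) (.seq (copy 31 21) (.seq (mulProg 28 31 32) .skip)))))) .skip)

/-- `mulProg` takes time linear in its first factor and destroys it; hence `n` and `p` are copied to
register `31` to act as counters, while the large powers are only added. -/
theorem powStepProg_spec {n p j : ℕ} {s : State} (h1 : s.reg 1 = 1) (hn : s.reg 2 = n)
    (h21 : s.reg 21 = p) (h3 : s.reg 3 = j + 1) (h4 : s.reg 4 = n ^ (j + 1))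
    (h28 : s.reg 28 = p ^ (2 * j)) (hpn : p ≤ n + 1) :
    ∃ s' j', Runs powStepProg s s' (20 * (n + 1) + 30) ∧
      j' = (if n ≤ p ^ (2 * j) then j else j + 1) ∧ s'.reg 3 = j' + 1 ∧
      s'.reg 4 = n ^ (j' + 1) ∧ s'.reg 28 = p ^ (2 * j') ∧ s'.mem = s.mem := by
  have hr := Runs.sub s 30 2 28
  rw [hn, h28] at hr
  by_cases hle : n ≤ p ^ (2 * j)
  · refine ⟨_, j, (hr.seq (Runs.ite_zero (by simp; omega) (.skip _))).mono (by omega),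
      by simp [hle], by simp [h3], by simp [h4], by simp [h28], by simp⟩
  set s1 := s.setReg 30 (n - p ^ (2 * j)) with hs1
  have hr1 := Runs.block (l := [.add 3 3 1, .const 31 0, .add 31 31 2]) rfl s1
  simp [blockStep, Prog.step, hs1, h1, hn, h3] at hr1
  rw [← hs1] at hr1
  set s2 := ((s1.setReg 3 (j + 1 + 1)).setReg 31 0).setReg 31 n with hs2
  obtain ⟨s3, hr2, e32, m3⟩ := mulProg_spec (d := 32) (a := 31) (b := 4) (s := s2) (by decide)
    (by decide) (by decide) (by decide) (by decide) (by simp [hs2, hs1, h1])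
  have hr3 := Runs.block (l := [.const 4 0, .add 4 4 32, .const 31 0, .add 31 31 21]) rfl s3
  set s4 := blockStep [.const 4 0, .add 4 4 32, .const 31 0, .add 31 31 21] s3 with hs4
  obtain ⟨s5, hr4, e32', m5⟩ := mulProg_spec (d := 32) (a := 31) (b := 28) (s := s4) (by decide)
    (by decide) (by decide) (by decide) (by decide)
    (by rw [hr3.frame (by decide), hr2.frame (by decide)]; simp [hs2, hs1, h1])
  have f21 : s3.reg 21 = p := by rw [hr2.frame (by decide)]; simp [hs2, hs1, h21]
  have f28 : s4.reg 28 = p ^ (2 * j) := by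
    rw [hr3.frame (by decide), hr2.frame (by decide)]; simp [hs2, hs1, h28]
  have f31 : s4.reg 31 = p := by simp [hs4, blockStep, Prog.step, f21]
  have f4 : s4.reg 4 = n ^ (j + 1 + 1) := by
    simp [hs4, blockStep, Prog.step, e32, hs2, hs1, h4]; ring
  have g21 : s5.reg 21 = p := by
    rw [hr4.frame (by decide), hr3.frame (by decide), f21]
  have hr5 := copy_spec (d := 31) (a := 21) (by decide) s5
  rw [g21] at hr5
  obtain ⟨s7, hr6, e28, m7⟩ := mulProg_spec (d := 28) (a := 31) (b := 32) (s := s5.setReg 31 p)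
    (by decide) (by decide) (by decide) (by decide) (by decide)
    (by
      rw [hr5.frame (by decide), hr4.frame (by decide), hr3.frame (by decide),
        hr2.frame (by decide)]
      simp [hs2, hs1, h1])
  have hrest := hr3.seq (hr4.seq (hr5.seq (hr6.seq (.skip s7))))
  refine ⟨s7, j + 1, (hr.seq (Runs.ite_pos (by simp [hs1]; omega) (hr1.seq (hr2.seq hrest)))).mono ?_,
    by simp [hle], ?_, ?_, ?_, ?_⟩
  · have b1 : blockCost [.add 3 3 1, .const 31 0, .add 31 31 2] = 4 := rfl
    have b2 : blockCost [.const 4 0, .add 4 4 32, .const 31 0, .add 31 31 21] = 5 := rfl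
    have b3 : s2.reg 31 = n := by simp [hs2]
    have b4 : (s5.setReg 31 p).reg 31 = p := by simp
    omega
  · rw [hrest.frame (by decide), hr2.frame (by decide)]; simp [hs2]
  · rw [hr6.frame (by decide), hr5.frame (by decide), hr4.frame (by decide), f4]
  · rw [e28]
    simp [e32', f31, f28]
    ring
  · rw [m7, State.mem_setReg, m5]
    simp [hs4, blockStep, Prog.step, m3, hs2, hs1]

/-- Compute the number of chosen generators. -/
def powProg : Prog :=
  .seq (block [.const 3 1, .const 4 0, .add 4 4 2, .const 28 1, .const 29 0, .add 29 29 2])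
    (forDown 29 powStepProg)

theorem powProg_spec {n p : ℕ} {s : State} (h1 : s.reg 1 = 1) (hn : s.reg 2 = n)
    (h21 : s.reg 21 = p) (hp2 : 2 ≤ p) (hpn : p ≤ n + 1) :
    ∃ s' j, Runs powProg s s' (70 * (n + 1) ^ 2) ∧ n ≤ p ^ (2 * j) ∧
      (j = 0 ∨ p ^ (2 * (j - 1)) < n) ∧ s'.reg 3 = j + 1 ∧ s'.reg 4 = n ^ (j + 1) ∧
      s'.mem = s.mem := by
  have hr := Runs.block (l := [.const 3 1, .const 4 0, .add 4 4 2, .const 28 1, .const 29 0,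
    .add 29 29 2]) rfl s
  set s1 := blockStep [.const 3 1, .const 4 0, .add 4 4 2, .const 28 1, .const 29 0,
    .add 29 29 2] s with hs1
  have h29 : s1.reg 29 = n := by simp [hs1, blockStep, Prog.step, hn]
  obtain ⟨s2, h2, j, ha, hb, hc, hd, he, hf⟩ := forDown_inv (c := 29) (P := powStepProg)
    (s₀ := s1)
    (fun k s' => ∃ j, s'.reg 3 = j + 1 ∧ s'.reg 4 = n ^ (j + 1) ∧ s'.reg 28 = p ^ (2 * j) ∧
      (j = 0 ∨ p ^ (2 * (j - 1)) < n) ∧ (n ≤ p ^ (2 * j) ∨ n - k ≤ j) ∧ s'.mem = s.mem)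
    (20 * (n + 1) + 30) (by decide) (by decide) (by decide)
    (by rw [hr.frame (by decide), h1])
    (by
      rw [h29]
      refine ⟨0, ?_, ?_, ?_, .inl rfl, .inr (by omega), ?_⟩ <;>
      simp [hs1, blockStep, Prog.step, hn])
    (fun k s' v h => by simpa using h) (by
      rintro k s' hk ⟨j, ha, hb, hc, hd, he, hf⟩ - hfr
      rw [h29] at hk
      obtain ⟨s2, j', g1, g2, g3, g4, g5, g6⟩ := powStepProg_spec (n := n) (p := p) (s := s')
        (by rw [hfr 1 (by decide) (by decide), hr.frame (by decide), h1])
        (by rw [hfr 2 (by decide) (by decide), hr.frame (by decide), hn])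
        (by rw [hfr 21 (by decide) (by decide), hr.frame (by decide), h21]) ha hb hc hpn
      refine ⟨s2, g1, j', g3, g4, g5, ?_, ?_, g6.trans hf⟩
      · rw [g2]
        split_ifs with h
        · exact hd
        · right; simpa using h
      · rw [g2]
        split_ifs with h
        · exact .inl h
        · right; omega)
  rw [h29] at h2
  refine ⟨s2, j, (hr.seq h2).mono ?_, ?_, hd, ha, hb, hf⟩
  · have : blockCost [.const 3 1, .const 4 0, .add 4 4 2, .const 28 1, .const 29 0,
      .add 29 29 2] = 7 := rfl
    nlinarith
  · refine he.elim id fun h => ?_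
    calc n ≤ 2 ^ n := Nat.lt_two_pow_self.le
      _ ≤ p ^ n := Nat.pow_le_pow_left hp2 n
      _ ≤ p ^ (2 * j) := Nat.pow_le_pow_right (by omega) (by omega)

/-- Compute the parameters. -/
def setupProg : Prog :=
  .seq (block [.const 1 1, .const 20 0, .load 2 20]) (.seq minFacProg (.seq powProg
    (.seq (copy 31 2) (.seq (mulProg 32 31 2)
      (block [.add 10 32 1, .add 6 10 32, .add 7 6 2, .add 8 7 2, .add 9 8 3, .const 5 1])))))

theorem setupProg_spec {n : ℕ} {s : State} (hn : s.mem 0 = n) (hn0 : 0 < n) :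
    ∃ s' p j, Runs setupProg s s' (150 * (n + 1) ^ 2) ∧ 2 ≤ p ∧
      (∀ q, 2 ≤ q → q ∣ n → p ≤ q) ∧ (2 ≤ n → p ∣ n) ∧
      n ≤ p ^ (2 * j) ∧ (j = 0 ∨ p ^ (2 * (j - 1)) < n) ∧
      Env n (j + 1) 1 (1 + n * n + n * n) s' ∧ s'.reg 4 = n ^ (j + 1) ∧
      s'.reg 10 = 1 + n * n ∧ s'.mem = s.mem := by
  have hr := Runs.block (l := [.const 1 1, .const 20 0, .load 2 20]) rfl s
  simp [blockStep, Prog.step, hn] at hr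
  set s1 := ((s.setReg 1 1).setReg 20 0).setReg 2 n with hs1
  obtain ⟨s2, hr2, hp2, hpn, hpmin, hpd, m2⟩ := minFacProg_spec (n := n) (s := s1) (by simp [hs1])
    (by simp [hs1]) hn0
  obtain ⟨s3, j, hr3, hj, hj', e3, e4, m3⟩ := powProg_spec (n := n) (s := s2)
    (by rw [hr2.frame (by decide)]; simp [hs1]) (by rw [hr2.frame (by decide)]; simp [hs1]) rfl
    hp2 hpn
  have f1 : s3.reg 1 = 1 := by
    rw [hr3.frame (by decide), hr2.frame (by decide)]; simp [hs1]
  have f2 : s3.reg 2 = n := by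
    rw [hr3.frame (by decide), hr2.frame (by decide)]; simp [hs1]
  have hr4 := copy_spec (d := 31) (a := 2) (by decide) s3
  rw [f2] at hr4
  obtain ⟨s5, hr5, e32, m5⟩ := mulProg_spec (d := 32) (a := 31) (b := 2) (s := s3.setReg 31 n)
    (by decide) (by decide) (by decide) (by decide) (by decide) (by simp [f1])
  have hr6 := Runs.block (l := [.add 10 32 1, .add 6 10 32, .add 7 6 2, .add 8 7 2, .add 9 8 3,
    .const 5 1]) rfl s5
  simp only [State.reg_setReg, if_true] at e32 hr5
  simp [f2] at e32
  have g1 : s5.reg 1 = 1 := by rw [hr5.frame (by decide)]; simp [f1]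
  have g2 : s5.reg 2 = n := by rw [hr5.frame (by decide)]; simp [f2]
  have g3 : s5.reg 3 = j + 1 := by rw [hr5.frame (by decide)]; simp [e3]
  have g4 : s5.reg 4 = n ^ (j + 1) := by rw [hr5.frame (by decide)]; simp [e4]
  refine ⟨_, s2.reg 21, j, (hr.seq (hr2.seq (hr3.seq (hr4.seq (hr5.seq hr6))))).mono ?_, hp2,
    hpmin, hpd, hj, hj', ?_, ?_, ?_, ?_⟩
  · have b1 : blockCost [.const 1 1, .const 20 0, .load 2 20] = 4 := rfl
    have b2 : blockCost [.add 10 32 1, .add 6 10 32, .add 7 6 2, .add 8 7 2, .add 9 8 3,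
      .const 5 1] = 7 := rfl
    nlinarith
  · constructor <;> simp [blockStep, Prog.step, g1, g2, g3, e32] <;> ring
  · simp [blockStep, Prog.step, g4]
  · simp [blockStep, Prog.step, g1, e32]; ring
  · simp [blockStep, Prog.step, m5, m3, m2, hs1]

/-! ### The input tables in memory. -/

/-- The remainder `r` lets the same statement serve the first table, which is followed by the
second, and the second, which is followed by nothing. -/
theorem getElem?_flatten_ofFn {m k : ℕ} (f : Fin k → Fin m → ℕ) (i : Fin k) (j : Fin m)
    (r : List ℕ) :
    ((List.ofFn fun i => List.ofFn fun j => f i j).flatten ++ r)[(i : ℕ) * m + j]? =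
      some (f i j) := by
  induction k with
  | zero => exact i.elim0
  | succ k ih =>
    rw [List.ofFn_succ, List.flatten_cons, List.append_assoc]
    refine Fin.cases ?_ (fun i => ?_) i
    · have hj := j.2
      rw [List.getElem?_append_left (by simp)]
      simp
    · rw [List.getElem?_append_right (by simp [Nat.succ_mul]; omega)]
      have := ih (fun i => f i.succ) i
      rw [← this]
      congr 1
      simp [Nat.succ_mul]
      omega

theorem length_flatten_ofFn {m k : ℕ} (f : Fin k → Fin m → ℕ) :
    (List.ofFn fun i => List.ofFn fun j => f i j).flatten.length = k * m := by
  induction k with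
  | zero => simp
  | succ k ih => rw [List.ofFn_succ, List.flatten_cons, List.length_append, ih]; simp; ring

section

variable {n : ℕ} (S T : Fin n → Fin n → Fin n)

theorem tablesInput_zero : (tablesInput S T).mem 0 = n := rfl

theorem tablesInput_fst (i j : Fin n) : (tablesInput S T).mem (i * n + j + 1) = S i j := by
  have := getElem?_flatten_ofFn (fun i j => (S i j : ℕ)) i j
    (List.ofFn fun i => List.ofFn fun j => (T i j : ℕ)).flatten
  simp only [tablesInput, List.cons_append, List.getD_eq_getElem?_getD, List.getElem?_cons_succ, this,
    Option.getD_some]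

theorem tablesInput_snd (i j : Fin n) :
    (tablesInput S T).mem (i * n + j + (1 + n * n)) = T i j := by
  have := getElem?_flatten_ofFn (fun i j => (T i j : ℕ)) i j []
  rw [List.append_nil] at this
  have h1 := length_flatten_ofFn fun i j => (S i j : ℕ)
  rw [show (i : ℕ) * n + j + (1 + n * n) = i * n + j + n * n + 1 by ring]
  simp only [tablesInput, List.cons_append, List.getD_eq_getElem?_getD, List.getElem?_cons_succ]
  rw [List.getElem?_append_right (by omega), h1, Nat.add_sub_cancel, this, Option.getD_some]

theorem tablesInput_eq_zero {a : ℕ} (ha : 1 + n * n + n * n ≤ a) :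
    (tablesInput S T).mem a = 0 := by
  have h1 := length_flatten_ofFn fun i j => (S i j : ℕ)
  have h2 := length_flatten_ofFn fun i j => (T i j : ℕ)
  refine List.getD_eq_default _ _ ?_
  rw [List.length_append, List.length_cons, h1, h2]
  omega

theorem tablesInput_le (a : ℕ) : (tablesInput S T).mem a ≤ n := by
  have hmem : ∀ x ∈ (n :: (List.ofFn fun i => List.ofFn fun j => (S i j : ℕ)).flatten)
      ++ (List.ofFn fun i => List.ofFn fun j => (T i j : ℕ)).flatten, x ≤ n := by
    intro x hx
    simp only [List.mem_append, List.mem_cons, List.mem_flatten, List.mem_ofFn] at hx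
    rcases hx with (rfl | ⟨_, ⟨i, rfl⟩, h⟩) | ⟨_, ⟨i, rfl⟩, h⟩
    · rfl
    all_goals
      obtain ⟨j, rfl⟩ := List.mem_ofFn.1 h
      exact Fin.is_le'
  simp only [tablesInput]
  generalize (n :: (List.ofFn fun i => List.ofFn fun j => (S i j : ℕ)).flatten)
      ++ (List.ofFn fun i => List.ofFn fun j => (T i j : ℕ)).flatten = L at hmem ⊢
  rcases Nat.lt_or_ge a L.length with h | h
  · rw [List.getD_eq_getElem _ _ h]
    exact hmem _ (List.getElem_mem h)
  · rw [List.getD_eq_default _ _ h]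
    exact Nat.zero_le n

end

/-! ### The whole program and its running time. -/

/-- The isomorphism test. -/
def isoProg : Prog := .seq setupProg searchProg

theorem isoProg_spec {G H : Type*} [Group G] [Group H] {n : ℕ} (e : G ≃ Fin n) (f : H ≃ Fin n) :
    ∃ (s : State) (t p j : ℕ), Exec isoProg (tablesInput (mulTable e) (mulTable f)) s t ∧
      (s.reg 0 = 1 ↔ Nonempty (G ≃* H)) ∧ 2 ≤ p ∧
      (∀ q, 2 ≤ q → q ∣ n → p ≤ q) ∧ (2 ≤ n → p ∣ n) ∧ (j = 0 ∨ p ^ (2 * (j - 1)) < n) ∧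
      t ≤ 10 ^ 8 * (j + 2) ^ 2 * (n + 1) ^ 8 * (n ^ (j + 1) + 1) := by
  classical
  have hn0 : 0 < n := (Nat.zero_le _).trans_lt (e 1).2
  have : NeZero n := ⟨hn0.ne'⟩
  set s0 := tablesInput (mulTable e) (mulTable f) with hs0
  obtain ⟨s1, p, j, ⟨t1, hx1, hb1⟩, hp2, hpmin, hpd, hj, hj', hE, h4, h10, hm⟩ :=
    setupProg_spec (s := s0) (tablesInput_zero _ _) hn0
  have hr0 : s1.reg 0 = 0 := hx1.frame 0 (by decide)
  -- All input values are at most $n < 2^n$; this crude word length `n` costs only a polynomial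
  -- factor.
  have hbd : s0.Bounded n := ⟨fun i => by positivity,
    fun a => (tablesInput_le _ _ a).trans_lt Nat.lt_two_pow_self⟩
  obtain ⟨hbd1, ht1⟩ := hb1 n hbd
  have hz : ∀ a, 1 + n * n + n * n ≤ a → s1.mem a = 0 := fun a ha => by
    rw [hm]; exact tablesInput_eq_zero _ _ ha
  have hT : IsTable e 1 s1.mem := fun g h => by
    rw [hm, hs0, tablesInput_fst]; simp [mulTable]
  have hT' : IsTable f (1 + n * n) s1.mem := fun g h => by
    rw [hm, hs0, tablesInput_snd]; simp [mulTable]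
  obtain ⟨s2, t2, hx2, hiff, ht2⟩ := searchProg_spec e f hT hT' (by omega) (by omega)
    ⟨hE, fun _ _ => rfl, fun i _ => by rw [hz _ (by omega)]; omega,
      fun r _ => by rw [hz _ (by omega)]; simp⟩
    hbd1.2 hbd1 hr0 h4 h10 fun q => hz _ (by omega)
  refine ⟨s2, _, p, j, hx1.seq hx2, hiff.trans (nonempty_mulEquiv_iff e f hp2 hpmin hj).symm, hp2,
    hpmin, hpd, hj', ?_⟩
  have hN : 1 ≤ n ^ (j + 1) := Nat.one_le_pow _ _ hn0
  generalize n ^ (j + 1) = N at *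
  obtain ⟨x, hx⟩ : ∃ x, (n + 1) ^ 4 = x := ⟨_, rfl⟩
  -- The unit steps of a round and the word length after the setup are both constant multiples of $y
  -- = (j+2)(n+1)^4$ at most, so a round costs $O(y^2)$.
  obtain ⟨y, hy⟩ : ∃ y, (j + 2) * x = y := ⟨_, rfl⟩
  have hxn : n + 1 ≤ x := hx ▸ Nat.le_self_pow (by decide) _
  have hxn2 : (n + 1) ^ 2 ≤ x := hx ▸ Nat.pow_le_pow_right (by omega) (by decide)
  have hxy : x ≤ y := hy ▸ Nat.le_mul_of_pos_left _ (by omega)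
  have e1 : 10 ^ 8 * (j + 2) ^ 2 * (n + 1) ^ 8 * (N + 1) = 10 ^ 8 * (y * y) * (N + 1) := by
    rw [← hy, ← hx]; ring
  have e2 : 600 * (j + 1 + 1) * (n + 1) ^ 4 = 600 * y := by rw [← hy, ← hx]; ring
  rw [e2] at ht2
  rw [e1]
  have a1 : t1 ≤ 300 * y * (151 * y) :=
    ht1.trans (Nat.mul_le_mul (by omega) (by omega))
  have a2 : (2 * (600 * y + 2)) * (n + 150 * (n + 1) ^ 2 + 600 * y + 2) ≤
      (2 * (602 * y)) * (753 * y) := Nat.mul_le_mul (by omega) (by omega)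
  have a3 := Nat.mul_le_mul_left (N + 1) a2
  have a4 : y ≤ y * y := Nat.le_mul_self y
  have a5 : y * y ≤ y * y * (N + 1) := Nat.le_mul_of_pos_right _ (by omega)
  have a6 : 20 * (n + 150 * (n + 1) ^ 2 + 3) ≤ 20 * (154 * y) := by omega
  calc t1 + t2 ≤ 300 * y * (151 * y) + (20 * (154 * y) +
        2 * ((N + 1) * ((2 * (602 * y)) * (753 * y)))) :=
        Nat.add_le_add a1 (ht2.trans (Nat.add_le_add a6 (Nat.mul_le_mul_left 2 a3)))
    _ = 45300 * (y * y) + (3080 * y + 1813224 * (y * y * (N + 1))) := by ring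
    _ ≤ 100000000 * (y * y * (N + 1)) := by omega
    _ = 10 ^ 8 * (y * y) * (N + 1) := by ring

end RAM

theorem mainTheorem1 :
    ∃ (P : RAM.Prog) (C : ℝ),
      ∀ (n : ℕ) (G : Type*) (H : Type*) [Group G] [Group H] (eG : G ≃ Fin n) (eH : H ≃ Fin n),
        ∃ (s : RAM.State) (t : ℕ),
          RAM.Exec P (tablesInput (mulTable eG) (mulTable eH)) s t ∧
          (s.reg 0 = 1 ↔ Nonempty (G ≃* H)) ∧
          ∀ p : ℕ, IsLeast {q : ℕ | q.Prime ∧ q ∣ n} p →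
            (t : ℝ) ≤ (n : ℝ) ^ ((1 / 2 : ℝ) * Real.logb p n + C) := by
  refine ⟨RAM.isoProg, 50, fun n G H _ _ eG eH => ?_⟩
  obtain ⟨s, t, p, j, hx, hiff, hp2, hpmin, hpd, hj, ht⟩ := RAM.isoProg_spec eG eH
  refine ⟨s, t, hx, hiff, fun p' hp' => ?_⟩
  obtain ⟨⟨hprime, hdvd⟩, hleast⟩ := hp'
  have hn0 : 0 < n := (Nat.zero_le _).trans_lt (eG 1).2
  have hn2 : 2 ≤ n := hprime.two_le.trans (Nat.le_of_dvd hn0 hdvd)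
  -- The program finds the least divisor that is at least $2$; its least prime factor again divides
  -- `n`, so it is the smallest prime divisor.
  obtain rfl : p' = p := by
    refine le_antisymm ?_ (hpmin p' hprime.two_le hdvd)
    exact (hleast ⟨Nat.minFac_prime (by omega), (Nat.minFac_dvd p).trans (hpd hn2)⟩).trans
      (Nat.minFac_le (by omega))
  have hp1 : (1 : ℝ) < p' := by exact_mod_cast hp2
  have hn1 : (1 : ℝ) < n := by exact_mod_cast hn2
  have hnR : (0 : ℝ) < n := by positivity
  have hlog : 0 ≤ Real.logb p' n := Real.logb_nonneg hp1 hn1.le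
  -- Minimality of `j` gives $2(j-1) < \log_p n$, unless $j = 0$.
  have hjlog : (j : ℝ) ≤ 1 / 2 * Real.logb p' n + 1 := by
    rcases hj with rfl | hj
    · push_cast; linarith
    · rcases j with _ | j
      · push_cast; linarith
      have h1 : ((2 * j : ℕ) : ℝ) < Real.logb p' n := by
        rw [Real.lt_logb_iff_rpow_lt hp1 hnR, Real.rpow_natCast]
        exact_mod_cast hj
      push_cast at h1 ⊢
      linarith
  have hjn : j + 2 ≤ n ^ 2 := by
    have hjn' : j ≤ n := by
      rcases hj with rfl | hj
      · omega
      · have h1 : 2 * (j - 1) < 2 ^ (2 * (j - 1)) := Nat.lt_two_pow_self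
        have h2 : 2 ^ (2 * (j - 1)) ≤ p' ^ (2 * (j - 1)) := Nat.pow_le_pow_left hp2 _
        omega
    nlinarith
  -- Since $n \ge 2$ and $10^8 \le 2^{27}$, the factors contribute exponents $27$, $4$, $16$ and
  -- $j+2$. One more unit comes from rounding `j` up, whence $C = 50$.
  have hnat : t ≤ n ^ (j + 49) := by
    have b1 : 10 ^ 8 ≤ n ^ 27 := le_trans (by norm_num) (Nat.pow_le_pow_left hn2 27)
    have b2 : (j + 2) ^ 2 ≤ (n ^ 2) ^ 2 := Nat.pow_le_pow_left hjn 2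
    have b3 : (n + 1) ^ 8 ≤ (n ^ 2) ^ 8 := Nat.pow_le_pow_left (by nlinarith) 8
    have b4 : n ^ (j + 1) + 1 ≤ n ^ (j + 2) := by
      have : 1 ≤ n ^ (j + 1) := Nat.one_le_pow _ _ hn0
      rw [pow_succ n (j + 1)]
      nlinarith
    calc t ≤ 10 ^ 8 * (j + 2) ^ 2 * (n + 1) ^ 8 * (n ^ (j + 1) + 1) := ht
      _ ≤ n ^ 27 * (n ^ 2) ^ 2 * (n ^ 2) ^ 8 * n ^ (j + 2) := by gcongr
      _ = n ^ (j + 49) := by ring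
  calc (t : ℝ) ≤ (n : ℝ) ^ (j + 49) := by exact_mod_cast hnat
    _ = (n : ℝ) ^ ((j + 49 : ℕ) : ℝ) := (Real.rpow_natCast _ _).symm
    _ ≤ (n : ℝ) ^ ((1 / 2 : ℝ) * Real.logb p' n + 50) := by
      refine Real.rpow_le_rpow_of_exponent_le hn1.le ?_
      push_cast
      linarith
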